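/- For a group $G$, let $\gamma_n(G)$ ($n\ge 1$, $\gamma_1(G)=G$) be the terms of its lower central series, let $\mathfrak g$ be the augmentation ideal of the integral group ring $\mathbb Z[G]$, and let $D_4(G)=\{g\in G : g-1\in\mathfrak g^4\}$ be the fourth dimension subgroup. A free presentation of $G$ is a surjective homomorphism $F\twoheadrightarrow G$ from a free group $F$, with kernel denoted $R$, written $R\hookrightarrow F\twoheadrightarrow G$; a morphism of free presentations of $G$ is a homomorphism of the free groups compatible with the maps to $G$. The assignments $$(R\hookrightarrow F\twoheadrightarrow G)\mapsto \frac{R\cap\gamma_2(F)}{\gamma_2(R)(R\cap\gamma_4(F))},\qquad (R\hookrightarrow F\twoheadrightarrow G)\mapsto \frac{\gamma_2(F)}{\gamma_2(R)\gamma_4(F)}$$ are functors from the category of free presentations of $G$ to the category of abelian groups; let $\varprojlim$ denote their limits over this category (these limits exist and are functors of $G$). Theorem. For every group $G$ there is a short exact sequence of abelian groups, natural in $G$, $$0\to\varprojlim \frac{R\cap \gamma_2(F)}{\gamma_2(R)(R\cap \gamma_4(F))}\longrightarrow \varprojlim \frac{\gamma_2(F)}{\gamma_2(R)\gamma_4(F)}\longrightarrow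 \frac{D_4(G)}{\gamma_4(G)}\to 0,$$ in which the first map is induced by the inclusions $R\cap\gamma_2(F)\subseteq\gamma_2(F)$, and the second map, followed by the inclusion $D_4(G)/\gamma_4(G)\subseteq\gamma_2(G)/\gamma_4(G)$, is for every free presentation $R\hookrightarrow F\twoheadrightarrow G$ the composite $$\varprojlim\frac{\gamma_2(F)}{\gamma_2(R)\gamma_4(F)}\to\frac{\gamma_2(F)}{\gamma_2(R)\gamma_4(F)}\to\frac{\gamma_2(G)}{\gamma_4(G)}$$ of the limit projection and the map induced by $F\twoheadrightarrow G$. -/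

import Mathlib

open CategoryTheory CategoryTheory.Limits
open scoped commutatorElement

universe u

namespace DimQuot

/-! ### Abelian subquotients of groups -/

section Subquotient

variable {F F' : Type u} [Group F] [Group F']

theorem normal_of_commutator_le {H N : Subgroup F} (h : ⁅H, H⁆ ≤ N) :
    (N.subgroupOf H).Normal where
  conj_mem n hn g := by
    rw [Subgroup.mem_subgroupOf] at hn ⊢
    have h1 : ⁅(g : F), (n : F)⁆ ∈ N := h (Subgroup.commutator_mem_commutator g.2 n.2)
    have h2 : ((g * n * g⁻¹ : H) : F) = ⁅(g : F), (n : F)⁆ * n := by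
      simp [commutatorElement_def]
    rw [h2]
    exact N.mul_mem h1 hn

/-- The quotient group `H / (N ∩ H)`, which is abelian if `[H, H] ≤ N`. -/
abbrev quotCommGroup (H N : Subgroup F) (h : ⁅H, H⁆ ≤ N) : CommGroup (H ⧸ N.subgroupOf H) :=
  haveI := normal_of_commutator_le h
  { (inferInstance : Group (H ⧸ N.subgroupOf H)) with
    mul_comm := by
      intro a b
      induction a using QuotientGroup.induction_on with | _ x
      induction b using QuotientGroup.induction_on with | _ y
      rw [← QuotientGroup.mk_mul, ← QuotientGroup.mk_mul, QuotientGroup.eq,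
        Subgroup.mem_subgroupOf]
      have h1 : ⁅((y : F))⁻¹, ((x : F))⁻¹⁆ ∈ N :=
        h (Subgroup.commutator_mem_commutator (H.inv_mem y.2) (H.inv_mem x.2))
      simpa [commutatorElement_def, mul_assoc] using h1 }

/-- The abelian group `H / (N ∩ H)` for subgroups `N`, `H` of a group with `[H, H] ≤ N`
(in all uses below `N ≤ H`, so that this is `H / N`), written additively. -/
def subquot (H N : Subgroup F) (h : ⁅H, H⁆ ≤ N) : AddCommGrpCat.{u} :=
  letI := quotCommGroup H N h
  AddCommGrpCat.of (Additive (H ⧸ N.subgroupOf H))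

/-- The class of an element of `H` in `H / N`. -/
def subquotMk (H N : Subgroup F) (h : ⁅H, H⁆ ≤ N) (x : H) : subquot H N h :=
  Additive.ofMul (QuotientGroup.mk x : H ⧸ N.subgroupOf H)

theorem subquotMk_surjective (H N : Subgroup F) (h : ⁅H, H⁆ ≤ N) :
    Function.Surjective (subquotMk H N h) := fun y => by
  obtain ⟨x, hx⟩ := QuotientGroup.mk_surjective (s := N.subgroupOf H) (Additive.toMul y)
  exact ⟨x, congrArg Additive.ofMul hx⟩

/-- The homomorphism `H / N ⟶ H' / N'`, `x N ↦ f(x) N'`, induced by a group homomorphism `f`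
with `f(H) ≤ H'` and `f(N) ≤ N'`. -/
def subquotMap {H N : Subgroup F} (h : ⁅H, H⁆ ≤ N) {H' N' : Subgroup F'} (h' : ⁅H', H'⁆ ≤ N')
    (f : F →* F') (hH : H ≤ H'.comap f) (hN : N ≤ N'.comap f) :
    subquot H N h ⟶ subquot H' N' h' :=
  letI := quotCommGroup H N h
  letI := quotCommGroup H' N' h'
  haveI := normal_of_commutator_le h
  haveI := normal_of_commutator_le h'
  AddCommGrpCat.ofHom (MonoidHom.toAdditive
    (QuotientGroup.map (N.subgroupOf H) (N'.subgroupOf H')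
      ((f.comp H.subtype).codRestrict H' fun x => hH x.2) fun _ hx => hN hx))

theorem subquotMap_mk {H N : Subgroup F} (h : ⁅H, H⁆ ≤ N) {H' N' : Subgroup F'}
    (h' : ⁅H', H'⁆ ≤ N') (f : F →* F') (hH : H ≤ H'.comap f) (hN : N ≤ N'.comap f) (x : H) :
    subquotMap h h' f hH hN (subquotMk H N h x) = subquotMk H' N' h' ⟨f x, hH x.2⟩ := rfl

theorem subquot_hom_ext {H N : Subgroup F} {h : ⁅H, H⁆ ≤ N} {A : AddCommGrpCat.{u}}
    {f g : subquot H N h ⟶ A} (hfg : ∀ x, f (subquotMk H N h x) = g (subquotMk H N h x)) :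
    f = g := by
  ext y
  obtain ⟨x, rfl⟩ := subquotMk_surjective H N h y
  exact hfg x

end Subquotient

/-! ### Lower central series, dimension subgroups, dimension quotients -/

section Series

/-- The `n`-th term `γ_n(G)`, `n ≥ 1`, of the lower central series, with `γ_1(G) = G`. -/
abbrev gamma (n : ℕ) (G : Type u) [Group G] : Subgroup G :=
  (⊤ : Subgroup G).lowerCentralSeries (n - 1)

theorem gamma_le_comap (n : ℕ) {G H : Type u} [Group G] [Group H] (f : G →* H) :
    gamma n G ≤ (gamma n H).comap f := by
  have key : ∀ k : ℕ, ((⊤ : Subgroup G).map f).lowerCentralSeries k ≤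
      (⊤ : Subgroup H).lowerCentralSeries k := by
    intro k
    induction k with
    | zero => exact le_top
    | succ k ih => exact Subgroup.commutator_mono ih le_top
  rw [← Subgroup.map_le_iff_le_comap, Subgroup.map_lowerCentralSeries]
  exact key _

theorem commutator_gamma_two_le (G : Type u) [Group G] : ⁅gamma 2 G, gamma 2 G⁆ ≤ gamma 4 G := by
  have h1 : ⁅⁅(⊤ : Subgroup G), gamma 2 G⁆, (⊤ : Subgroup G)⁆ ≤ gamma 4 G := by
    rw [Subgroup.commutator_comm ⊤]
    exact le_rfl
  have h2 : ⁅⁅gamma 2 G, (⊤ : Subgroup G)⁆, (⊤ : Subgroup G)⁆ ≤ gamma 4 G := le_rfl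
  have bot_iff : ∀ A B C : Subgroup G, ⁅⁅A, B⁆, C⁆ ≤ gamma 4 G ↔
      ⁅⁅A.map (QuotientGroup.mk' (gamma 4 G)), B.map (QuotientGroup.mk' (gamma 4 G))⁆,
        C.map (QuotientGroup.mk' (gamma 4 G))⁆ = ⊥ := fun A B C => by
    rw [← Subgroup.map_commutator, ← Subgroup.map_commutator, Subgroup.map_eq_bot_iff,
      QuotientGroup.ker_mk']
  have h3 : ⁅⁅(⊤ : Subgroup G), ⊤⁆, gamma 2 G⁆ ≤ gamma 4 G :=
    (bot_iff _ _ _).2 (Subgroup.commutator_commutator_eq_bot_of_rotate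
      ((bot_iff _ _ _).1 h1) ((bot_iff _ _ _).1 h2))
  exact h3

/-- The augmentation ideal of the integral group ring: the kernel of the ring homomorphism
`ℤ[G] → ℤ` that sends every element of `G` to `1`. -/
noncomputable def augIdeal (G : Type u) [Group G] : Ideal (MonoidAlgebra ℤ G) :=
  RingHom.ker (MonoidAlgebra.lift ℤ ℤ G (1 : G →* ℤ))

/-- The `n`-th dimension subgroup `D_n(G) = {g ∈ G | g - 1 ∈ 𝔤 ^ n}`. -/
noncomputable def dimSubgroup (n : ℕ) (G : Type u) [Group G] : Subgroup G where
  carrier := {g | MonoidAlgebra.of ℤ G g - 1 ∈ augIdeal G ^ n}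
  one_mem' := by
    change MonoidAlgebra.of ℤ G 1 - 1 ∈ augIdeal G ^ n
    rw [map_one, sub_self]
    exact zero_mem _
  mul_mem' {a b} ha hb := by
    change MonoidAlgebra.of ℤ G (a * b) - 1 ∈ augIdeal G ^ n
    have : MonoidAlgebra.of ℤ G (a * b) - 1 =
        MonoidAlgebra.of ℤ G a * (MonoidAlgebra.of ℤ G b - 1) + (MonoidAlgebra.of ℤ G a - 1) := by
      rw [map_mul]; noncomm_ring
    rw [this]
    exact add_mem (Ideal.mul_mem_left _ _ hb) ha
  inv_mem' {a} ha := by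
    change MonoidAlgebra.of ℤ G a⁻¹ - 1 ∈ augIdeal G ^ n
    have : MonoidAlgebra.of ℤ G a⁻¹ - 1 =
        (-MonoidAlgebra.of ℤ G a⁻¹) * (MonoidAlgebra.of ℤ G a - 1) := by
      rw [mul_sub, neg_mul, ← map_mul, inv_mul_cancel, map_one]; noncomm_ring
    rw [this]
    exact Ideal.mul_mem_left _ _ ha

theorem dimSubgroup_le_comap (n : ℕ) {G H : Type u} [Group G] [Group H] (f : G →* H) :
    dimSubgroup n G ≤ (dimSubgroup n H).comap f := by
  let Φ : MonoidAlgebra ℤ G →ₐ[ℤ] MonoidAlgebra ℤ H :=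
    MonoidAlgebra.lift ℤ (MonoidAlgebra ℤ H) G ((MonoidAlgebra.of ℤ H).comp f)
  have hof : ∀ g, Φ (MonoidAlgebra.of ℤ G g) = MonoidAlgebra.of ℤ H (f g) := fun g =>
    MonoidAlgebra.lift_of _ _
  have hcomp : (MonoidAlgebra.lift ℤ ℤ H (1 : H →* ℤ)).comp Φ =
      MonoidAlgebra.lift ℤ ℤ G (1 : G →* ℤ) := by
    refine MonoidAlgebra.algHom_ext (fun g => ?_) (Subsingleton.elim _ _)
    change MonoidAlgebra.lift ℤ ℤ H (1 : H →* ℤ) (Φ (MonoidAlgebra.of ℤ G g)) =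
      MonoidAlgebra.lift ℤ ℤ G (1 : G →* ℤ) (MonoidAlgebra.of ℤ G g)
    rw [hof, MonoidAlgebra.lift_of, MonoidAlgebra.lift_of]; rfl
  have h1 : ∀ x ∈ augIdeal G, Φ x ∈ augIdeal H := by
    intro x hx
    change (MonoidAlgebra.lift ℤ ℤ H (1 : H →* ℤ)).comp Φ x = 0
    rw [hcomp]
    exact hx
  have h2 : ∀ (k : ℕ), ∀ x ∈ augIdeal G ^ k, Φ x ∈ augIdeal H ^ k := by
    intro k
    induction k with
    | zero => intro x _; rw [Submodule.pow_zero, Ideal.one_eq_top]; exact Submodule.mem_top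
    | succ k ih =>
      have : augIdeal G ^ (k + 1) ≤ (augIdeal H ^ (k + 1)).comap Φ := by
        rw [Submodule.pow_succ, Submodule.pow_succ]
        refine Ideal.mul_le.2 fun r hr s hs => ?_
        rw [Ideal.mem_comap, map_mul]
        exact Ideal.mul_mem_mul (ih r hr) (h1 s hs)
      exact this
  intro g hg
  have := h2 n _ hg
  rw [map_sub, map_one, hof] at this
  exact this

theorem dimSubgroup_four_le (G : Type u) [Group G] : dimSubgroup 4 G ≤ gamma 2 G := by
  let M := Additive (Abelianization G)
  let _ : Module ℤᵐᵒᵖ M :=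
    Module.compHom M ((RingHom.id ℤ).fromOpposite fun _ _ => mul_comm _ _)
  have : IsCentralScalar ℤ M := ⟨fun _ _ => rfl⟩
  let v : G →* TrivSqZeroExt ℤ M :=
    { toFun g := 1 + TrivSqZeroExt.inr (Additive.ofMul (Abelianization.of g))
      map_one' := by simp
      map_mul' a b := by
        rw [map_mul, ofMul_mul, TrivSqZeroExt.inr_add, mul_add, add_mul, add_mul,
          TrivSqZeroExt.inr_mul_inr]
        simp [add_assoc] }
  let Φ : MonoidAlgebra ℤ G →ₐ[ℤ] TrivSqZeroExt ℤ M := MonoidAlgebra.lift ℤ _ G v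
  have hof : ∀ g, Φ (MonoidAlgebra.of ℤ G g) = v g := fun g => MonoidAlgebra.lift_of _ _
  have hcomp : (TrivSqZeroExt.fstHom ℤ ℤ M).comp Φ =
      MonoidAlgebra.lift ℤ ℤ G (1 : G →* ℤ) := by
    refine MonoidAlgebra.algHom_ext (fun g => ?_) (Subsingleton.elim _ _)
    change (Φ (MonoidAlgebra.of ℤ G g)).fst =
      MonoidAlgebra.lift ℤ ℤ G (1 : G →* ℤ) (MonoidAlgebra.of ℤ G g)
    rw [hof, MonoidAlgebra.lift_of]
    simp [v]
  have h1 : ∀ x ∈ augIdeal G, (Φ x).fst = 0 := by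
    intro x hx
    change (TrivSqZeroExt.fstHom ℤ ℤ M).comp Φ x = 0
    rw [hcomp]
    exact hx
  have h2 : augIdeal G ^ 2 ≤ RingHom.ker Φ := by
    rw [Submodule.pow_succ, Submodule.pow_one]
    refine Ideal.mul_le.2 fun r hr s hs => ?_
    rw [RingHom.mem_ker, map_mul]
    ext
    · simp [h1 r hr]
    · simp [h1 r hr, h1 s hs]
  have : (augIdeal G).IsTwoSided := inferInstanceAs (RingHom.ker _).IsTwoSided
  have h24 : augIdeal G ^ 4 ≤ augIdeal G ^ 2 :=
    (Ideal.IsTwoSided.pow_add (I := augIdeal G) 2 2).le.trans Ideal.mul_le_right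
  intro g hg
  have h4 : MonoidAlgebra.of ℤ G g - 1 ∈ augIdeal G ^ 2 :=
    h24 hg
  have h5 : Φ (MonoidAlgebra.of ℤ G g - 1) = 0 := h2 h4
  rw [map_sub, map_one, hof] at h5
  have hv : v g = 1 + TrivSqZeroExt.inr (Additive.ofMul (Abelianization.of g)) := rfl
  rw [hv, add_sub_cancel_left] at h5
  have h6 : Additive.ofMul (Abelianization.of g) = (0 : M) := by
    have := congrArg TrivSqZeroExt.snd h5
    rwa [TrivSqZeroExt.snd_zero, TrivSqZeroExt.snd_inr] at this
  have h7 : Abelianization.of g = 1 := h6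
  have h8 : g ∈ (Abelianization.of : G →* Abelianization G).ker := h7
  rw [Abelianization.ker_of] at h8
  exact h8

theorem commutator_dimSubgroup_four_le (G : Type u) [Group G] :
    ⁅dimSubgroup 4 G, dimSubgroup 4 G⁆ ≤ gamma 4 G :=
  (Subgroup.commutator_mono (dimSubgroup_four_le G) (dimSubgroup_four_le G)).trans
    (commutator_gamma_two_le G)

/-- The fourth dimension quotient `D_4(G) / γ_4(G)`, as a functor of `G`. -/
noncomputable def dimQuotFour : GrpCat.{u} ⥤ AddCommGrpCat.{u} where
  obj G := subquot (dimSubgroup 4 G) (gamma 4 G) (commutator_dimSubgroup_four_le G)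
  map f := subquotMap _ _ f.hom (dimSubgroup_le_comap 4 f.hom) (gamma_le_comap 4 f.hom)
  map_id _ := subquot_hom_ext fun _ => rfl
  map_comp _ _ := subquot_hom_ext fun _ => rfl

/-- `γ_2(G) / γ_4(G)`, as a functor of `G`. -/
def gammaQuot : GrpCat.{u} ⥤ AddCommGrpCat.{u} where
  obj G := subquot (gamma 2 G) (gamma 4 G) (commutator_gamma_two_le G)
  map f := subquotMap _ _ f.hom (gamma_le_comap 2 f.hom) (gamma_le_comap 4 f.hom)
  map_id _ := subquot_hom_ext fun _ => rfl
  map_comp _ _ := subquot_hom_ext fun _ => rfl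

/-- The inclusion `D_4(G) / γ_4(G) ⟶ γ_2(G) / γ_4(G)`. -/
noncomputable def dimQuotIncl : dimQuotFour.{u} ⟶ gammaQuot.{u} where
  app G := subquotMap (commutator_dimSubgroup_four_le G) (commutator_gamma_two_le G)
    (MonoidHom.id G) (dimSubgroup_four_le G) le_rfl
  naturality _ _ _ := subquot_hom_ext fun _ => rfl

end Series

/-! ### Free presentations and limits over them -/

/-- A free presentation of `G`: a surjective homomorphism from a free group onto `G`. -/
structure FreePresentation (G : Type u) [Group G] where
  /-- the free group -/
  F : Type u
  [group : Group F]
  [free : IsFreeGroup F]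
  /-- the projection -/
  π : F →* G
  surj : Function.Surjective π

attribute [instance] FreePresentation.group FreePresentation.free

/-- Morphisms of free presentations of `G`: homomorphisms over `G`. -/
@[ext] structure FreePresentation.Hom {G : Type u} [Group G] (P Q : FreePresentation G) where
  /-- the homomorphism of free groups -/
  f : P.F →* Q.F
  comm : ∀ x, Q.π (f x) = P.π x

/-- The category of free presentations of `G`. -/
instance (G : Type u) [Group G] : Category.{u} (FreePresentation.{u} G) where
  Hom P Q := FreePresentation.Hom P Q
  id P := ⟨MonoidHom.id P.F, fun _ => rfl⟩
  comp a b := ⟨b.f.comp a.f, fun x => (b.comm (a.f x)).trans (a.comm x)⟩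

/-- A group together with a free presentation of it. -/
structure Presentation where
  /-- the presented group -/
  G : GrpCat.{u}
  /-- its presentation -/
  P : FreePresentation G

/-- Morphisms `(F → G) ⟶ (F' → G')`: commutative squares. -/
@[ext] structure Presentation.Hom (P Q : Presentation.{u}) where
  /-- the homomorphism of free groups -/
  f : P.P.F →* Q.P.F
  /-- the homomorphism of presented groups -/
  φ : P.G ⟶ Q.G
  comm : ∀ x, Q.P.π (f x) = φ.hom (P.P.π x)

/-- The category of free presentations of varying groups. -/
instance : Category.{u} Presentation.{u} where
  Hom P Q := Presentation.Hom P Q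
  id P := ⟨MonoidHom.id P.P.F, 𝟙 P.G, fun _ => rfl⟩
  comp a b := ⟨b.f.comp a.f, a.φ ≫ b.φ, fun x =>
    (b.comm (a.f x)).trans (congrArg b.φ.hom (a.comm x))⟩

/-- The functor `(F → G) ↦ G`. -/
def presented : Presentation.{u} ⥤ GrpCat.{u} where
  obj P := P.G
  map a := a.φ

/-- The category of free presentations of the fixed group `G`, mapped into the category of all
free presentations (morphisms become squares that are the identity on `G`). -/
def fibre (G : GrpCat.{u}) : FreePresentation.{u} G ⥤ Presentation.{u} where
  obj P := ⟨G, P⟩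
  map a := ⟨a.f, 𝟙 G, a.comm⟩

section Limits

/-- The presentation of `G` on the generators `X` through `v : X → G`. -/
def presentationOf (G : GrpCat.{u}) {X : Type u} (v : X → G) (hv : Function.Surjective v) :
    FreePresentation G where
  F := FreeGroup X
  π := FreeGroup.lift v
  surj g := by
    obtain ⟨x, rfl⟩ := hv g
    exact ⟨FreeGroup.of x, FreeGroup.lift_apply_of⟩

/-- The standard presentation, on the elements of `G` as generators. -/
def std (G : GrpCat.{u}) : FreePresentation G :=
  presentationOf G (fun g : G => g) fun g => ⟨g, rfl⟩

/-- The coproduct of the standard presentation with itself. -/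
def stdTwo (G : GrpCat.{u}) : FreePresentation G :=
  presentationOf G (Sum.elim (fun g : G => g) fun g : G => g) fun g => ⟨Sum.inl g, rfl⟩

/-- Morphisms from a presentation on generators are determined by suitable values on them. -/
def descHom {G H : GrpCat.{u}} {X : Type u} (v : X → G) (hv : Function.Surjective v)
    (φ : G ⟶ H) (Q : FreePresentation H) (w : X → Q.F) (hw : ∀ x, Q.π (w x) = φ.hom (v x)) :
    (fibre G).obj (presentationOf G v hv) ⟶ (fibre H).obj Q where
  f := FreeGroup.lift w
  φ := φ
  comm := by
    have : Q.π.comp (FreeGroup.lift w) = φ.hom.comp (FreeGroup.lift v) :=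
      FreeGroup.ext_hom _ _ fun x => by
        simp only [MonoidHom.comp_apply, FreeGroup.lift_apply_of, hw]
    exact DFunLike.congr_fun this

theorem hom_ext_of {G H : GrpCat.{u}} {X : Type u} {v : X → G} {hv : Function.Surjective v}
    {Q : FreePresentation H} {a b : (fibre G).obj (presentationOf G v hv) ⟶ (fibre H).obj Q}
    (hφ : a.φ = b.φ) (hf : ∀ x, a.f (FreeGroup.of x) = b.f (FreeGroup.of x)) : a = b :=
  Presentation.Hom.ext (FreeGroup.ext_hom _ _ hf) hφ

/-- The first coproduct inclusion. -/
def stdInl (G : GrpCat.{u}) : std G ⟶ stdTwo G :=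
  let d := descHom (fun g : G => g) (fun g => ⟨g, rfl⟩) (𝟙 G) (stdTwo G)
    (fun g => FreeGroup.of (Sum.inl g)) fun _ => FreeGroup.lift_apply_of
  ⟨d.f, d.comm⟩

/-- The second coproduct inclusion. -/
def stdInr (G : GrpCat.{u}) : std G ⟶ stdTwo G :=
  let d := descHom (fun g : G => g) (fun g => ⟨g, rfl⟩) (𝟙 G) (stdTwo G)
    (fun g => FreeGroup.of (Sum.inr g)) fun _ => FreeGroup.lift_apply_of
  ⟨d.f, d.comm⟩

/-- A homomorphism `φ : G ⟶ H` lifts to a morphism from the standard presentation of `G` to any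
free presentation of `H`. -/
noncomputable def stdLift {G H : GrpCat.{u}} (φ : G ⟶ H) (Q : FreePresentation H) :
    (fibre G).obj (std G) ⟶ (fibre H).obj Q :=
  descHom _ _ φ Q (fun g => (Q.surj (φ.hom g)).choose) fun g => (Q.surj (φ.hom g)).choose_spec

/-- Two lifts of `φ` are jointly induced by a lift from the coproduct. -/
theorem exists_copair {G H : GrpCat.{u}} {Q : FreePresentation H}
    (a b : (fibre G).obj (std G) ⟶ (fibre H).obj Q) (hab : a.φ = b.φ) :
    ∃ c : (fibre G).obj (stdTwo G) ⟶ (fibre H).obj Q,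
      (fibre G).map (stdInl G) ≫ c = a ∧ (fibre G).map (stdInr G) ≫ c = b := by
  have ha : ∀ g : G, Q.π (a.f (FreeGroup.of g)) = a.φ.hom g := fun g =>
    (a.comm _).trans (congrArg a.φ.hom FreeGroup.lift_apply_of)
  have hb : ∀ g : G, Q.π (b.f (FreeGroup.of g)) = a.φ.hom g := fun g =>
    hab ▸ (b.comm _).trans (congrArg b.φ.hom FreeGroup.lift_apply_of)
  let w : G ⊕ G → Q.F :=
    Sum.elim (fun g => a.f (FreeGroup.of g)) fun g => b.f (FreeGroup.of g)
  have hw : ∀ x, Q.π (w x) = a.φ.hom (Sum.elim (fun g : G => g) (fun g : G => g) x) := by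
    rintro (g | g)
    · exact ha g
    · exact hb g
  have hL : ∀ x, FreeGroup.lift w (FreeGroup.of x) = w x := fun x => FreeGroup.lift_apply_of
  refine ⟨descHom _ _ a.φ Q w hw, hom_ext_of (Category.id_comp _) fun g => ?_,
    hom_ext_of ((Category.id_comp _).trans hab) fun g => ?_⟩
  · exact (congrArg (FreeGroup.lift w) FreeGroup.lift_apply_of).trans (hL _)
  · exact (congrArg (FreeGroup.lift w) FreeGroup.lift_apply_of).trans (hL _)

variable (T : Presentation.{u} ⥤ AddCommGrpCat.{u})

theorem comp_eq_of_lift {A : AddCommGrpCat.{u}} {G H : GrpCat.{u}} {Q : FreePresentation H}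
    (s : A ⟶ T.obj ((fibre G).obj (std G)))
    (hs : s ≫ T.map ((fibre G).map (stdInl G)) = s ≫ T.map ((fibre G).map (stdInr G)))
    (a b : (fibre G).obj (std G) ⟶ (fibre H).obj Q) (hab : a.φ = b.φ) :
    s ≫ T.map a = s ≫ T.map b := by
  obtain ⟨c, rfl, rfl⟩ := exists_copair a b hab
  rw [T.map_comp, T.map_comp, reassoc_of% hs]

theorem cone_inl_eq_inr {G : GrpCat.{u}} (s : Cone (fibre G ⋙ T)) :
    s.π.app (std G) ≫ T.map ((fibre G).map (stdInl G)) =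
      s.π.app (std G) ≫ T.map ((fibre G).map (stdInr G)) :=
  (s.w (stdInl G)).trans (s.w (stdInr G)).symm

/-- A morphism of presentations of a fixed group, from a square that is the identity on it. -/
def ofSquare {G : GrpCat.{u}} {P Q : FreePresentation G}
    (a : (fibre G).obj P ⟶ (fibre G).obj Q) (ha : a.φ = 𝟙 G) : P ⟶ Q where
  f := a.f
  comm x := (a.comm x).trans (by rw [ha]; rfl)

theorem fibre_map_ofSquare {G : GrpCat.{u}} {P Q : FreePresentation G}
    (a : (fibre G).obj P ⟶ (fibre G).obj Q) (ha : a.φ = 𝟙 G) :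
    (fibre G).map (ofSquare a ha) = a :=
  Presentation.Hom.ext rfl ha.symm

theorem cone_std {G : GrpCat.{u}} (s : Cone (fibre G ⋙ T)) {Q : FreePresentation G}
    (a : (fibre G).obj (std G) ⟶ (fibre G).obj Q) (ha : a.φ = 𝟙 G) :
    s.π.app (std G) ≫ T.map a = s.π.app Q := by
  have := s.w (ofSquare a ha)
  rwa [Functor.comp_map, fibre_map_ofSquare] at this

/-- Limits over the (large) category of free presentations of `G` exist. -/
instance hasLimit_fibre (G : GrpCat.{u}) : HasLimit (fibre G ⋙ T) := by
  let i := T.map ((fibre G).map (stdInl G))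
  let j := T.map ((fibre G).map (stdInr G))
  let c : Cone (fibre G ⋙ T) :=
    { pt := equalizer i j
      π :=
        { app Q := equalizer.ι i j ≫ T.map (stdLift (𝟙 G) Q)
          naturality Q Q' a := by
            have := comp_eq_of_lift T (equalizer.ι i j) (equalizer.condition i j)
              (stdLift (𝟙 G) Q') (stdLift (𝟙 G) Q ≫ (fibre G).map a)
              (Category.id_comp (𝟙 G)).symm
            simpa using this } }
  have hι : c.π.app (std G) = equalizer.ι i j :=
    (comp_eq_of_lift T (equalizer.ι i j) (equalizer.condition i j)
      (stdLift (𝟙 G) (std G)) (𝟙 _) rfl).trans (by simp)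
  exact ⟨⟨c,
    { lift s := equalizer.lift (s.π.app (std G)) (cone_inl_eq_inr T s)
      fac s Q := by
        change equalizer.lift _ _ ≫ equalizer.ι i j ≫ T.map (stdLift (𝟙 G) Q) = _
        rw [equalizer.lift_ι_assoc]
        exact cone_std T s _ rfl
      uniq s m hm := by
        apply equalizer.hom_ext
        rw [equalizer.lift_ι, ← hm (std G), hι] }⟩⟩

theorem freeLim_naturality {G H : GrpCat.{u}} (φ : G ⟶ H) {Q Q' : FreePresentation H}
    (a : Q ⟶ Q') :
    (limit.π (fibre G ⋙ T) (std G) ≫ T.map (stdLift φ Q)) ≫ T.map ((fibre H).map a) =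
      limit.π (fibre G ⋙ T) (std G) ≫ T.map (stdLift φ Q') := by
  rw [Category.assoc, ← T.map_comp]
  exact comp_eq_of_lift T _ (cone_inl_eq_inr T (limit.cone _)) _ _ (Category.comp_id φ)

/-- The map `lim T(F → G) ⟶ lim T(F' → H)` induced by `φ : G ⟶ H`; it is compatible with every
square over `φ`. -/
noncomputable def freeLimMap {G H : GrpCat.{u}} (φ : G ⟶ H) :
    limit (fibre G ⋙ T) ⟶ limit (fibre H ⋙ T) :=
  limit.lift (fibre H ⋙ T)
    { pt := limit (fibre G ⋙ T)
      π :=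
        { app Q := limit.π (fibre G ⋙ T) (std G) ≫ T.map (stdLift φ Q)
          naturality _ _ a := (Category.id_comp _).trans (freeLim_naturality T φ a).symm } }

theorem freeLimMap_π {G H : GrpCat.{u}} (φ : G ⟶ H) {P : FreePresentation G}
    {Q : FreePresentation H} (a : (fibre G).obj P ⟶ (fibre H).obj Q) (ha : a.φ = φ) :
    freeLimMap T φ ≫ limit.π (fibre H ⋙ T) Q = limit.π (fibre G ⋙ T) P ≫ T.map a := by
  have h1 : freeLimMap T φ ≫ limit.π (fibre H ⋙ T) Q =
      limit.π (fibre G ⋙ T) (std G) ≫ T.map (stdLift φ Q) := limit.lift_π _ _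
  have h2 : limit.π (fibre G ⋙ T) (std G) ≫ T.map (stdLift (𝟙 G) P) =
      limit.π (fibre G ⋙ T) P := cone_std T (limit.cone _) _ rfl
  rw [h1, ← h2, Category.assoc, ← T.map_comp]
  exact comp_eq_of_lift T _ (cone_inl_eq_inr T (limit.cone _)) _ _
    (ha.symm.trans (Category.id_comp a.φ).symm)

/-- The functor `G ↦ lim T(F → G)`, the limit being taken over the category of free
presentations of the fixed group `G`. -/
noncomputable def freeLim : GrpCat.{u} ⥤ AddCommGrpCat.{u} where
  obj G := limit (fibre G ⋙ T)
  map φ := freeLimMap T φ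
  map_id G := limit.hom_ext fun Q => by
    rw [freeLimMap_π T (𝟙 G) (𝟙 ((fibre G).obj Q)) rfl, T.map_id, Category.id_comp]
    exact Category.comp_id _
  map_comp {G H K} φ ψ := limit.hom_ext fun Q => by
    rw [freeLimMap_π T (φ ≫ ψ) (stdLift φ (std H) ≫ stdLift ψ Q) rfl, Category.assoc,
      freeLimMap_π T ψ (stdLift ψ Q) rfl, T.map_comp, ← Category.assoc, ← Category.assoc,
      freeLimMap_π T φ (stdLift φ (std H)) rfl]

/-- The projection `lim T(F → G) ⟶ T(F → G)`. -/
noncomputable def freeLimProj (G : GrpCat.{u}) (P : FreePresentation G) :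
    (freeLim T).obj G ⟶ T.obj ⟨G, P⟩ :=
  limit.π (fibre G ⋙ T) P

theorem limMap_comp_π {T T' : Presentation.{u} ⥤ AddCommGrpCat.{u}} (α : T ⟶ T')
    (G : GrpCat.{u}) (P : FreePresentation G) :
    limMap (Functor.whiskerLeft (fibre G) α) ≫ limit.π (fibre G ⋙ T') P =
      limit.π (fibre G ⋙ T) P ≫ α.app ((fibre G).obj P) := limMap_π _ _

/-- The map on limits induced by a natural transformation. -/
noncomputable def freeLimHom {T T' : Presentation.{u} ⥤ AddCommGrpCat.{u}} (α : T ⟶ T') :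
    freeLim T ⟶ freeLim T' where
  app G := limMap (Functor.whiskerLeft (fibre G) α)
  naturality G H φ := by
    change freeLimMap T φ ≫ limMap (Functor.whiskerLeft (fibre H) α) =
      limMap (Functor.whiskerLeft (fibre G) α) ≫ freeLimMap T' φ
    refine limit.hom_ext fun Q => ?_
    rw [Category.assoc, Category.assoc, limMap_comp_π,
      freeLimMap_π T' φ (stdLift φ Q) rfl, ← Category.assoc, ← Category.assoc,
      freeLimMap_π T φ (stdLift φ Q) rfl, limMap_comp_π, Category.assoc, Category.assoc,
      α.naturality]

end Limits

/-! ### The two functors of free presentations -/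

section Functors

/-- The kernel `R` of a free presentation `R ↪ F ↠ G`. -/
abbrev rel (P : Presentation.{u}) : Subgroup P.P.F := P.P.π.ker

theorem rel_le_comap {P Q : Presentation.{u}} (a : P ⟶ Q) : rel P ≤ (rel Q).comap a.f :=
  fun x hx => by
    have hx' : P.P.π x = 1 := hx
    change Q.P.π (a.f x) = 1
    rw [a.comm, hx', map_one]

theorem commutator_rel_le_comap {P Q : Presentation.{u}} (a : P ⟶ Q) :
    ⁅rel P, rel P⁆ ≤ ⁅rel Q, rel Q⁆.comap a.f := by
  rw [← Subgroup.map_le_iff_le_comap, Subgroup.map_commutator]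
  have := Subgroup.map_le_iff_le_comap.2 (rel_le_comap a)
  exact Subgroup.commutator_mono this this

theorem sup_le_comap {F F' : Type u} [Group F] [Group F'] {f : F →* F'} {A B : Subgroup F}
    {A' B' : Subgroup F'} (hA : A ≤ A'.comap f) (hB : B ≤ B'.comap f) :
    A ⊔ B ≤ (A' ⊔ B').comap f :=
  sup_le (hA.trans (Subgroup.comap_mono le_sup_left)) (hB.trans (Subgroup.comap_mono le_sup_right))

/-- The functor `(R ↪ F ↠ G) ↦ (R ∩ γ_2(F)) / (γ_2(R) (R ∩ γ_4(F)))`. The product of the two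
normal subgroups is their join `⊔`. -/
def relQuot : Presentation.{u} ⥤ AddCommGrpCat.{u} where
  obj P := subquot (rel P ⊓ gamma 2 P.P.F) (⁅rel P, rel P⁆ ⊔ (rel P ⊓ gamma 4 P.P.F))
    ((Subgroup.commutator_mono inf_le_left inf_le_left).trans le_sup_left)
  map a := subquotMap _ _ a.f
    (inf_le_inf (rel_le_comap a) (gamma_le_comap 2 a.f))
    (sup_le_comap (commutator_rel_le_comap a)
      (inf_le_inf (rel_le_comap a) (gamma_le_comap 4 a.f)))
  map_id _ := subquot_hom_ext fun _ => rfl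
  map_comp _ _ := subquot_hom_ext fun _ => rfl

/-- The functor `(R ↪ F ↠ G) ↦ γ_2(F) / (γ_2(R) γ_4(F))`. -/
def freeQuot : Presentation.{u} ⥤ AddCommGrpCat.{u} where
  obj P := subquot (gamma 2 P.P.F) (⁅rel P, rel P⁆ ⊔ gamma 4 P.P.F)
    ((commutator_gamma_two_le _).trans le_sup_right)
  map a := subquotMap _ _ a.f (gamma_le_comap 2 a.f)
    (sup_le_comap (commutator_rel_le_comap a) (gamma_le_comap 4 a.f))
  map_id _ := subquot_hom_ext fun _ => rfl
  map_comp _ _ := subquot_hom_ext fun _ => rfl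

/-- The map induced by the inclusion `R ∩ γ_2(F) ≤ γ_2(F)`. -/
def relIncl : relQuot.{u} ⟶ freeQuot.{u} where
  app P := subquotMap _ _ (MonoidHom.id P.P.F) inf_le_right
    (sup_le_sup le_rfl inf_le_right)
  naturality _ _ _ := subquot_hom_ext fun _ => rfl

/-- The map `γ_2(F) / (γ_2(R) γ_4(F)) ⟶ γ_2(G) / γ_4(G)` induced by `F ↠ G`. -/
def freeProj : freeQuot.{u} ⟶ presented.{u} ⋙ gammaQuot.{u} where
  app P := subquotMap _ (commutator_gamma_two_le P.G) P.P.π (gamma_le_comap 2 P.P.π)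
    (sup_le ((Subgroup.commutator_le_left _ _).trans fun x hx => by
      have hx' : P.P.π x = 1 := hx
      rw [Subgroup.mem_comap, hx']
      exact one_mem _) (gamma_le_comap 4 P.P.π))
  naturality P Q a := subquot_hom_ext fun x =>
    congrArg (subquotMk (gamma 2 Q.G) (gamma 4 Q.G) (commutator_gamma_two_le Q.G))
      (Subtype.ext (a.comm x))

end Functors

end DimQuot

/-!
For a normal subgroup `N` of `Γ`, write `Δ(N)` for the ideal generated by the `n - 1`, and `𝔤`, `𝔣`,
`𝔯` for `Δ(G)`, `Δ(F)`, `Δ(R)`. Since `Δ(N) / Δ(Γ)Δ(N)` is the abelianization of `N`, every `g` with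
`g - 1 ∈ 𝔤 ^ n` lifts to some `x` in `F` with `x - 1 ∈ 𝔣𝔯 + 𝔣 ^ n`. If `a, b : F → F'` are morphisms
of presentations, then `a x` and `b x` differ by an element of `γ₂(R')(R' ∩ γₙ(F'))`, because
`Δ(R')Δ(F') ^ (n - 1) ≤ Δ(F')Δ(R') + Δ(R' ∩ γₙ(F'))`. So `x` defines an element of the limit.

Conversely, take for `a, b` the inclusions into the coproduct of the standard presentation with
itself. A Fox derivative with values in `𝔤` that is `u ↦ u - 1` on the first copy of `F` and zero on
the second one vanishes on `γ₂(R')` and maps `γₙ(F')` into `𝔤 ^ n`. Therefore, if `a x` and `b x`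
agree modulo `γ₂(R')γₙ(F')`, the image of `x` in `G` lies in the `n`-th dimension subgroup.
-/

namespace DimQuot

open MonoidAlgebra (of mapDomainRingHom)
open scoped MonoidAlgebra

section GroupRing

variable {Γ : Type*} [Group Γ]

/-- The subgroup of all `g` with `g ≡ 1` modulo a left ideal of the group ring. For the powers of
the augmentation ideal these are the dimension subgroups. -/
def congruenceSubgroup (J : Ideal ℤ[Γ]) : Subgroup Γ where
  carrier := {g | of ℤ Γ g - 1 ∈ J}
  one_mem' := by rw [Set.mem_ofPred_eq, map_one, sub_self]; exact J.zero_mem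
  mul_mem' {a b} ha hb := by
    have h : of ℤ Γ (a * b) - 1 = of ℤ Γ a * (of ℤ Γ b - 1) + (of ℤ Γ a - 1) := by
      rw [map_mul]; noncomm_ring
    rw [Set.mem_ofPred_eq, h]
    exact J.add_mem (J.mul_mem_left _ hb) ha
  inv_mem' {a} ha := by
    have h : of ℤ Γ a⁻¹ - 1 = -of ℤ Γ a⁻¹ * (of ℤ Γ a - 1) := by
      rw [neg_mul, mul_sub, ← map_mul, inv_mul_cancel, map_one, mul_one, neg_sub]
    rw [Set.mem_ofPred_eq, h]
    exact J.mul_mem_left _ ha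

theorem mem_congruenceSubgroup {J : Ideal ℤ[Γ]} {g : Γ} :
    g ∈ congruenceSubgroup J ↔ of ℤ Γ g - 1 ∈ J := Iff.rfl

theorem inv_mul_mem_congruenceSubgroup {J : Ideal ℤ[Γ]} {a b : Γ} :
    a⁻¹ * b ∈ congruenceSubgroup J ↔ of ℤ Γ b - of ℤ Γ a ∈ J := by
  have h₁ : of ℤ Γ (a⁻¹ * b) - 1 = of ℤ Γ a⁻¹ * (of ℤ Γ b - of ℤ Γ a) := by
    rw [mul_sub, ← map_mul, ← map_mul, inv_mul_cancel, map_one]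
  have h₂ : of ℤ Γ b - of ℤ Γ a = of ℤ Γ a * (of ℤ Γ (a⁻¹ * b) - 1) := by
    rw [mul_sub, ← map_mul, mul_inv_cancel_left, mul_one]
  exact ⟨fun h => h₂ ▸ J.mul_mem_left _ h,
    fun h => mem_congruenceSubgroup.2 (h₁ ▸ J.mul_mem_left _ h)⟩

theorem commutator_congruenceSubgroup_le (I J : Ideal ℤ[Γ]) :
    ⁅congruenceSubgroup I, congruenceSubgroup J⁆ ≤ congruenceSubgroup (I * J ⊔ J * I) := by
  refine Subgroup.commutator_le.2 fun a ha b hb => ?_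
  have h₁ : ⁅a, b⁆ = (b⁻¹ * a⁻¹)⁻¹ * (a⁻¹ * b⁻¹) := by rw [commutatorElement_def]; group
  have h₂ : of ℤ Γ (a⁻¹ * b⁻¹) - of ℤ Γ (b⁻¹ * a⁻¹) =
      (of ℤ Γ a⁻¹ - 1) * (of ℤ Γ b⁻¹ - 1) - (of ℤ Γ b⁻¹ - 1) * (of ℤ Γ a⁻¹ - 1) := by
    rw [map_mul, map_mul]; noncomm_ring
  rw [h₁, inv_mul_mem_congruenceSubgroup, h₂]
  exact sub_mem
    (Ideal.mem_sup_left (Ideal.mul_mem_mul (inv_mem ha) (inv_mem hb)))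
    (Ideal.mem_sup_right (Ideal.mul_mem_mul (inv_mem hb) (inv_mem ha)))

/-- The augmentation homomorphism `ℤ[Γ] → ℤ`, with kernel `augIdeal Γ`. -/
noncomputable def augmentation (Γ : Type*) [Group Γ] : ℤ[Γ] →ₐ[ℤ] ℤ :=
  MonoidAlgebra.lift ℤ ℤ Γ 1

theorem augmentation_of (u : Γ) : augmentation Γ (of ℤ Γ u) = 1 :=
  MonoidAlgebra.lift_of _ _

theorem mem_augIdeal {z : ℤ[Γ]} : z ∈ augIdeal Γ ↔ augmentation Γ z = 0 := Iff.rfl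

theorem of_sub_one_mem_augIdeal (u : Γ) : of ℤ Γ u - 1 ∈ augIdeal Γ := by
  rw [mem_augIdeal, map_sub, map_one, augmentation_of, sub_self]

instance : (augIdeal Γ).IsTwoSided := inferInstanceAs (RingHom.ker _).IsTwoSided

theorem gamma_succ_le_congruenceSubgroup (n : ℕ) :
    gamma (n + 1) Γ ≤ congruenceSubgroup (augIdeal Γ ^ (n + 1)) := by
  have h : (⊤ : Subgroup Γ) ≤ congruenceSubgroup (augIdeal Γ) :=
    fun g _ => of_sub_one_mem_augIdeal g
  induction n with
  | zero => rwa [zero_add, Submodule.pow_one]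
  | succ n ih =>
    have hpow : augIdeal Γ ^ (n + 1) * augIdeal Γ ⊔ augIdeal Γ * augIdeal Γ ^ (n + 1) =
        augIdeal Γ ^ (n + 2) := by
      rw [← Submodule.pow_succ, ← Submodule.pow_succ' _ n.succ_ne_zero, sup_idem]
    exact (Subgroup.commutator_mono ih h).trans (hpow ▸ commutator_congruenceSubgroup_le _ _)

/-- The relative augmentation ideal `Δ(N)` of a subgroup `N`: the left ideal of the group ring
generated by the elements `n - 1` with `n` in `N`. It is the kernel of `ℤ[Γ] → ℤ[Γ / N]` if `N` is
normal, and the augmentation ideal if `N = Γ`. -/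
noncomputable def relAugIdeal (N : Subgroup Γ) : Ideal ℤ[Γ] :=
  Ideal.span ((fun n => of ℤ Γ n - 1) '' N)

theorem relAugIdeal_le_iff {N : Subgroup Γ} {J : Ideal ℤ[Γ]} :
    relAugIdeal N ≤ J ↔ N ≤ congruenceSubgroup J := by
  rw [relAugIdeal, Ideal.span_le, Set.image_subset_iff]; rfl

theorem le_congruenceSubgroup_relAugIdeal (N : Subgroup Γ) :
    N ≤ congruenceSubgroup (relAugIdeal N) :=
  relAugIdeal_le_iff.1 le_rfl

theorem relAugIdeal_mono {M N : Subgroup Γ} (h : M ≤ N) : relAugIdeal M ≤ relAugIdeal N :=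
  relAugIdeal_le_iff.2 (h.trans (le_congruenceSubgroup_relAugIdeal N))

theorem relAugIdeal_induction {N : Subgroup Γ} (A : AddSubgroup ℤ[Γ])
    (h : ∀ u, ∀ n ∈ N, of ℤ Γ u * (of ℤ Γ n - 1) ∈ A) {z : ℤ[Γ]} (hz : z ∈ relAugIdeal N) :
    z ∈ A := by
  induction hz using Submodule.closure_induction with
  | zero => exact A.zero_mem
  | add _ _ _ _ hx hy => exact A.add_mem hx hy
  | smul_mem z _ hn =>
    obtain ⟨n, hn, rfl⟩ := hn
    induction z using MonoidAlgebra.induction_on with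
    | of u => exact h u n hn
    | add x y hx hy => rw [add_smul]; exact A.add_mem hx hy
    | smul k x hx => rw [smul_assoc]; exact A.zsmul_mem hx k

instance (N : Subgroup Γ) [N.Normal] : (relAugIdeal N).IsTwoSided where
  mul_mem_of_left {a} b ha := by
    induction b using MonoidAlgebra.induction_on with
    | of u =>
      refine relAugIdeal_induction
        ((relAugIdeal N).toAddSubgroup.comap (AddMonoidHom.mulRight (of ℤ Γ u)))
        (fun v n hn => ?_) ha
      have h : of ℤ Γ v * (of ℤ Γ n - 1) * of ℤ Γ u =
          of ℤ Γ (v * u) * (of ℤ Γ (u⁻¹ * n * u) - 1) := by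
        rw [mul_sub, sub_mul, mul_sub, mul_one, mul_one, ← map_mul, ← map_mul, ← map_mul,
          ← map_mul]
        congr 2; group
      change of ℤ Γ v * (of ℤ Γ n - 1) * of ℤ Γ u ∈ relAugIdeal N
      rw [h]
      exact Ideal.mul_mem_left _ _ (le_congruenceSubgroup_relAugIdeal N
        (by simpa only [inv_inv] using ‹N.Normal›.conj_mem n hn u⁻¹))
    | add x y hx hy => rw [mul_add]; exact add_mem hx hy
    | smul k x hx => rw [mul_smul_comm]; exact zsmul_mem hx k

theorem mem_relAugIdeal_of_map_eq_zero {B : Type*} [AddCommGroup B] {N : Subgroup Γ}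
    (f : ℤ[Γ] →+ B) (σ : B →+ ℤ[Γ]) (h : ∀ u, of ℤ Γ u - σ (f (of ℤ Γ u)) ∈ relAugIdeal N)
    {z : ℤ[Γ]} (hz : f z = 0) : z ∈ relAugIdeal N := by
  have key : z - σ (f z) ∈ relAugIdeal N := by
    clear hz
    induction z using MonoidAlgebra.induction_on with
    | of u => exact h u
    | add x y hx hy => rw [map_add, map_add, add_sub_add_comm]; exact add_mem hx hy
    | smul k x hx => rw [map_zsmul, map_zsmul, ← smul_sub]; exact zsmul_mem hx k
  rwa [hz, map_zero, sub_zero] at key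

theorem augIdeal_eq_relAugIdeal_top : augIdeal Γ = relAugIdeal (⊤ : Subgroup Γ) := by
  refine le_antisymm (fun z hz => ?_) (relAugIdeal_le_iff.2 fun g _ => of_sub_one_mem_augIdeal g)
  refine mem_relAugIdeal_of_map_eq_zero (augmentation Γ).toAddMonoidHom (Int.castAddHom ℤ[Γ])
    (fun u => ?_) hz
  change of ℤ Γ u - ((augmentation Γ (of ℤ Γ u) : ℤ) : ℤ[Γ]) ∈ relAugIdeal ⊤
  rw [augmentation_of, Int.cast_one]
  exact le_congruenceSubgroup_relAugIdeal ⊤ (Subgroup.mem_top u)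

theorem relAugIdeal_mul_relAugIdeal_le (M N : Subgroup Γ) [M.Normal] :
    relAugIdeal M * relAugIdeal N ≤ relAugIdeal N * relAugIdeal M ⊔ relAugIdeal ⁅M, N⁆ := by
  have hgen : ∀ m ∈ M, ∀ n ∈ N, (of ℤ Γ m - 1) * (of ℤ Γ n - 1) ∈
      relAugIdeal N * relAugIdeal M ⊔ relAugIdeal ⁅M, N⁆ := fun m hm n hn => by
    have hcomm : (n * m)⁻¹ * (m * n) = ⁅m⁻¹, n⁻¹⁆ := by rw [commutatorElement_def]; group
    have hswap : (of ℤ Γ m - 1) * (of ℤ Γ n - 1) =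
        (of ℤ Γ n - 1) * (of ℤ Γ m - 1) + (of ℤ Γ (m * n) - of ℤ Γ (n * m)) := by
      rw [map_mul, map_mul]; noncomm_ring
    rw [hswap]
    refine Submodule.add_mem_sup (Ideal.mul_mem_mul (le_congruenceSubgroup_relAugIdeal N hn)
      (le_congruenceSubgroup_relAugIdeal M hm)) (inv_mul_mem_congruenceSubgroup.1 ?_)
    rw [hcomm]
    exact le_congruenceSubgroup_relAugIdeal _
      (Subgroup.commutator_mem_commutator (inv_mem hm) (inv_mem hn))
  have hleft : ∀ n ∈ N, ∀ z ∈ relAugIdeal M, z * (of ℤ Γ n - 1) ∈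
      relAugIdeal N * relAugIdeal M ⊔ relAugIdeal ⁅M, N⁆ := fun n hn z hz => by
    induction hz using Submodule.span_induction with
    | mem _ hm => obtain ⟨m, hm, rfl⟩ := hm; exact hgen m hm n hn
    | zero => rw [zero_mul]; exact zero_mem _
    | add _ _ _ _ hx hy => rw [add_mul]; exact add_mem hx hy
    | smul v _ _ hx => rw [smul_eq_mul, mul_assoc]; exact Ideal.mul_mem_left _ v hx
  refine Ideal.mul_le.2 fun z hz w hw => ?_
  induction hw using Submodule.closure_induction with
  | zero => rw [mul_zero]; exact zero_mem _
  | add _ _ _ _ hx hy => rw [mul_add]; exact add_mem hx hy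
  | smul_mem v _ hn =>
    obtain ⟨n, hn, rfl⟩ := hn
    rw [smul_eq_mul, ← mul_assoc]
    exact hleft n hn _ (Ideal.mul_mem_right v _ hz)

theorem relAugIdeal_mul_augIdeal_pow_le (N : Subgroup Γ) [N.Normal] (k : ℕ) :
    relAugIdeal N * augIdeal Γ ^ k ≤
      augIdeal Γ * relAugIdeal N ⊔ relAugIdeal (N ⊓ gamma (k + 1) Γ) := by
  induction k with
  | zero =>
    have h : N ⊓ gamma (0 + 1) Γ = N := inf_top_eq N
    rw [h]
    exact Ideal.mul_le_left.trans le_sup_right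
  | succ k ih =>
    have hcomm : ⁅N ⊓ gamma (k + 1) Γ, (⊤ : Subgroup Γ)⁆ ≤ N ⊓ gamma (k + 2) Γ :=
      le_inf
        ((Subgroup.commutator_mono inf_le_left le_rfl).trans (Subgroup.commutator_le_left _ _))
        (Subgroup.commutator_mono inf_le_right le_rfl)
    have hswap : relAugIdeal (N ⊓ gamma (k + 1) Γ) * augIdeal Γ ≤
        augIdeal Γ * relAugIdeal N ⊔ relAugIdeal (N ⊓ gamma (k + 2) Γ) := by
      rw [augIdeal_eq_relAugIdeal_top]
      exact (relAugIdeal_mul_relAugIdeal_le _ _).trans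
        (sup_le_sup (Ideal.mul_mono_right (relAugIdeal_mono inf_le_left)) (relAugIdeal_mono hcomm))
    calc relAugIdeal N * augIdeal Γ ^ (k + 1)
        = relAugIdeal N * augIdeal Γ ^ k * augIdeal Γ := by rw [Submodule.pow_succ, Ideal.mul_assoc]
      _ ≤ (augIdeal Γ * relAugIdeal N ⊔ relAugIdeal (N ⊓ gamma (k + 1) Γ)) * augIdeal Γ :=
          Ideal.mul_mono_left ih
      _ = augIdeal Γ * relAugIdeal N * augIdeal Γ ⊔
            relAugIdeal (N ⊓ gamma (k + 1) Γ) * augIdeal Γ := Ideal.sup_mul _ _ _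
      _ ≤ augIdeal Γ * relAugIdeal N ⊔ relAugIdeal (N ⊓ gamma (k + 2) Γ) :=
          sup_le (Ideal.mul_le_left.trans le_sup_left) hswap

theorem map_mul_of_mem_relAugIdeal {A M : Type*} [Ring A] [AddCommGroup M] [Module A M]
    {N : Subgroup Γ} (ρ : ℤ[Γ] →+* A) (D : ℤ[Γ] →+ M)
    (h : ∀ u, ∀ n ∈ N, D (of ℤ Γ u * (of ℤ Γ n - 1)) = ρ (of ℤ Γ u) • D (of ℤ Γ n - 1))
    (z : ℤ[Γ]) {w : ℤ[Γ]} (hw : w ∈ relAugIdeal N) : D (z * w) = ρ z • D w := by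
  refine relAugIdeal_induction ((D.comp (AddMonoidHom.mulLeft z)).eqLocus
    ((DistribSMul.toAddMonoidHom M (ρ z)).comp D)) (fun v n hn => ?_) hw
  change D (z * (of ℤ Γ v * (of ℤ Γ n - 1))) = ρ z • D (of ℤ Γ v * (of ℤ Γ n - 1))
  induction z using MonoidAlgebra.induction_on with
  | of u => rw [← mul_assoc, ← map_mul, h _ n hn, h v n hn, map_mul, map_mul, mul_smul]
  | add x y hx hy => rw [add_mul, map_add, hx, hy, map_add, add_smul]
  | smul k x hx => rw [smul_mul_assoc, map_zsmul, hx, map_zsmul, smul_assoc]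

theorem exists_sub_mem_augIdeal_mul_relAugIdeal {N : Subgroup Γ} {z : ℤ[Γ]}
    (hz : z ∈ relAugIdeal N) :
    ∃ n ∈ N, z - (of ℤ Γ n - 1) ∈ augIdeal Γ * relAugIdeal N := by
  let q := Submodule.mkQ (augIdeal Γ * relAugIdeal N)
  have hq {m : Γ} (hm : m ∈ N) (u : Γ) :
      q (of ℤ Γ u * (of ℤ Γ m - 1)) = q (of ℤ Γ m - 1) := (Submodule.Quotient.eq _).2 <| by
    rw [← sub_one_mul]
    exact Ideal.mul_mem_mul (of_sub_one_mem_augIdeal u) (le_congruenceSubgroup_relAugIdeal N hm)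
  let φ : Additive N →+ ℤ[Γ] ⧸ augIdeal Γ * relAugIdeal N :=
    AddMonoidHom.mk' (fun n => q (of ℤ Γ (n.toMul : Γ) - 1)) fun a b => by
      have h (u v : Γ) : of ℤ Γ (u * v) - 1 = (of ℤ Γ u - 1) + of ℤ Γ u * (of ℤ Γ v - 1) := by
        rw [map_mul]; noncomm_ring
      rw [toMul_add, Subgroup.coe_mul, h, map_add, hq b.toMul.2]
  obtain ⟨n, hn⟩ : z ∈ φ.range.comap q.toAddMonoidHom :=
    relAugIdeal_induction (φ.range.comap q.toAddMonoidHom)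
      (fun u n hn => Exists.intro (Additive.ofMul ⟨n, hn⟩) (hq hn u).symm) hz
  exact ⟨n.toMul, n.toMul.2, (Submodule.Quotient.eq _).1 hn.symm⟩

theorem exists_addMonoidHom_abelianization (N : Subgroup Γ) :
    ∃ θ : ℤ[Γ] →+ Additive (Abelianization N),
      ∀ u, ∀ n : N, θ (of ℤ Γ u * (of ℤ Γ n - 1)) = Additive.ofMul (Abelianization.of n) := by
  -- `c v` is the `N`-component of `v` for a choice of coset representatives of `N`.
  let c (v : Γ) : N := ⟨(v : Γ ⧸ N).out⁻¹ * v, QuotientGroup.eq.1 (Quotient.out_eq _)⟩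
  have hc : ∀ v, ∀ n : N, c (v * n) = c v * n := fun v n => Subtype.ext <| by
    simp only [c, QuotientGroup.mk_mul_of_mem v n.2, mul_assoc, Subgroup.coe_mul]
  let θ := (MonoidAlgebra.basis Γ ℤ).constr ℤ fun v => Additive.ofMul (Abelianization.of (c v))
  have hθ : ∀ v, θ (of ℤ Γ v) = Additive.ofMul (Abelianization.of (c v)) :=
    (MonoidAlgebra.basis Γ ℤ).constr_basis ℤ _
  refine ⟨θ.toAddMonoidHom, fun u n => ?_⟩
  change θ _ = _
  rw [mul_sub, mul_one, ← map_mul, map_sub, hθ, hθ, hc, map_mul, ofMul_mul, add_sub_cancel_left]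

theorem inf_congruenceSubgroup_le {N H : Subgroup Γ} (hH : H ≤ N) :
    N ⊓ congruenceSubgroup (augIdeal Γ * relAugIdeal N ⊔ relAugIdeal H) ≤ ⁅N, N⁆ ⊔ H := by
  rintro r ⟨hr, hr'⟩
  obtain ⟨θ, hθ⟩ := exists_addMonoidHom_abelianization N
  obtain ⟨p, hp, q, hq, hpq⟩ := Submodule.mem_sup.1 hr'
  have hmul : ∀ z, ∀ w ∈ relAugIdeal N, θ (z * w) = augmentation Γ z • θ w := fun z w hw =>
    map_mul_of_mem_relAugIdeal (augmentation Γ).toRingHom θ (fun u n hn => by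
      have h₁ := hθ 1 ⟨n, hn⟩
      rw [map_one, one_mul] at h₁
      exact (hθ u ⟨n, hn⟩).trans (by
        change _ = augmentation Γ (of ℤ Γ u) • _
        rw [augmentation_of, one_smul, h₁])) z hw
  have hp₀ : θ p = 0 := by
    refine Submodule.mul_induction_on hp (fun z hz w hw => ?_) fun x y hx hy => ?_
    · rw [hmul z w hw, mem_augIdeal.1 hz, zero_smul]
    · rw [map_add, hx, hy, add_zero]
  have hq₀ : θ q ∈ ((H.subgroupOf N).map Abelianization.of).toAddSubgroup :=
    relAugIdeal_induction (((H.subgroupOf N).map Abelianization.of).toAddSubgroup.comap θ)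
      (fun u n hn => Exists.intro ⟨n, hH hn⟩ ⟨hn, (hθ u ⟨n, hH hn⟩).symm⟩) hq
  obtain ⟨h, hh, hrh⟩ : ∃ h : N, (h : Γ) ∈ H ∧ Abelianization.of h = Abelianization.of ⟨r, hr⟩ := by
    have hr₀ := hθ 1 ⟨r, hr⟩
    rw [map_one, one_mul, ← hpq, map_add, hp₀, zero_add] at hr₀
    rw [hr₀] at hq₀
    exact hq₀
  have hcomm : (h : Γ)⁻¹ * r ∈ ⁅N, N⁆ := by
    have hker : h⁻¹ * ⟨r, hr⟩ ∈ commutator N := by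
      rw [← Abelianization.ker_of, MonoidHom.mem_ker, map_mul, map_inv, hrh, inv_mul_cancel]
    rw [← Subgroup.map_subtype_commutator]
    exact ⟨_, hker, rfl⟩
  simpa only [mul_inv_cancel_left] using
    mul_mem (Subgroup.mem_sup_right hh) (Subgroup.mem_sup_left (T := H) hcomm)

end GroupRing

section Map

variable {F G : Type*} [Group F] [Group G] (f : F →* G)

theorem mapDomainRingHom_of (u : F) : mapDomainRingHom ℤ f (of ℤ F u) = of ℤ G (f u) :=
  MonoidAlgebra.mapDomain_single

theorem augmentation_mapDomainRingHom (z : ℤ[F]) :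
    augmentation G (mapDomainRingHom ℤ f z) = augmentation F z := by
  induction z using MonoidAlgebra.induction_on with
  | of u => rw [mapDomainRingHom_of, augmentation_of, augmentation_of]
  | add x y hx hy => rw [map_add, map_add, hx, hy, map_add]
  | smul k x hx => rw [map_zsmul, map_zsmul, hx, map_zsmul]

theorem comap_augIdeal : (augIdeal G).comap (mapDomainRingHom ℤ f) = augIdeal F := by
  ext z
  rw [Ideal.mem_comap, mem_augIdeal, mem_augIdeal, augmentation_mapDomainRingHom]

theorem relAugIdeal_le_comap {M : Subgroup F} {N : Subgroup G} (h : M ≤ N.comap f) :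
    relAugIdeal M ≤ (relAugIdeal N).comap (mapDomainRingHom ℤ f) :=
  relAugIdeal_le_iff.2 fun m hm => by
    rw [mem_congruenceSubgroup, Ideal.mem_comap, map_sub, map_one, mapDomainRingHom_of]
    exact le_congruenceSubgroup_relAugIdeal N (h hm)

theorem augIdeal_pow_le_comap (k : ℕ) :
    augIdeal F ^ k ≤ (augIdeal G ^ k).comap (mapDomainRingHom ℤ f) := by
  induction k with
  | zero => rw [Submodule.pow_zero (augIdeal G), Ideal.one_eq_top]; exact le_top
  | succ k ih =>
    rw [Submodule.pow_succ, Submodule.pow_succ]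
    refine Ideal.mul_le.2 fun z hz w hw => ?_
    rw [Ideal.mem_comap, map_mul]
    exact Ideal.mul_mem_mul (ih hz) ((comap_augIdeal f).ge hw)

variable {f}

theorem mapDomainRingHom_surjective (hf : Function.Surjective f) :
    Function.Surjective (mapDomainRingHom ℤ f) := fun w => by
  induction w using MonoidAlgebra.induction_on with
  | of g => obtain ⟨u, rfl⟩ := hf g; exact ⟨of ℤ F u, mapDomainRingHom_of f u⟩
  | add x y hx hy =>
    obtain ⟨⟨x, rfl⟩, y, rfl⟩ := And.intro hx hy
    exact ⟨x + y, map_add _ x y⟩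
  | smul k x hx => obtain ⟨x, rfl⟩ := hx; exact ⟨k • x, map_zsmul _ k x⟩

theorem exists_mem_augIdeal_pow_map_eq (hf : Function.Surjective f) (k : ℕ) {w : ℤ[G]}
    (hw : w ∈ augIdeal G ^ k) : ∃ z ∈ augIdeal F ^ k, mapDomainRingHom ℤ f z = w := by
  induction k generalizing w with
  | zero =>
    rw [Submodule.pow_zero, Ideal.one_eq_top]
    simpa only [Submodule.mem_top, true_and] using mapDomainRingHom_surjective hf w
  | succ k ih =>
    rw [Submodule.pow_succ] at hw ⊢
    refine Submodule.mul_induction_on hw (fun x hx y hy => ?_) ?_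
    · obtain ⟨x, hx', rfl⟩ := ih hx
      obtain ⟨y, rfl⟩ := mapDomainRingHom_surjective hf y
      exact ⟨x * y, Ideal.mul_mem_mul hx' ((comap_augIdeal f).le hy), map_mul _ x y⟩
    · rintro _ _ ⟨x, hx, rfl⟩ ⟨y, hy, rfl⟩
      exact ⟨x + y, add_mem hx hy, map_add _ x y⟩

theorem ker_mapDomainRingHom_le (hf : Function.Surjective f) :
    RingHom.ker (mapDomainRingHom ℤ f) ≤ relAugIdeal f.ker := fun z hz => by
  let s := Function.surjInv hf
  refine mem_relAugIdeal_of_map_eq_zero (mapDomainRingHom ℤ f : ℤ[F] →+* ℤ[G]).toAddMonoidHom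
    ((MonoidAlgebra.basis G ℤ).constr ℤ fun g => of ℤ F (s g)).toAddMonoidHom (fun u => ?_) hz
  have hs : (s (f u))⁻¹ * u ∈ f.ker := by
    rw [MonoidHom.mem_ker, map_mul, map_inv, Function.surjInv_eq hf, inv_mul_cancel]
  change of ℤ F u - (MonoidAlgebra.basis G ℤ).constr ℤ (fun g => of ℤ F (s g))
    (mapDomainRingHom ℤ f (of ℤ F u)) ∈ relAugIdeal f.ker
  have hb : of ℤ G (f u) = MonoidAlgebra.basis G ℤ (f u) := rfl
  rw [mapDomainRingHom_of, hb, Module.Basis.constr_basis]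
  exact inv_mul_mem_congruenceSubgroup.1 (le_congruenceSubgroup_relAugIdeal _ hs)

theorem exists_lift_mem_congruenceSubgroup (hf : Function.Surjective f) {n : ℕ} {g : G}
    (hg : g ∈ congruenceSubgroup (augIdeal G ^ n)) :
    ∃ x ∈ congruenceSubgroup (augIdeal F * relAugIdeal f.ker ⊔ augIdeal F ^ n), f x = g := by
  obtain ⟨z, hz, hzg⟩ := exists_mem_augIdeal_pow_map_eq hf n hg
  obtain ⟨y, rfl⟩ := hf g
  have hker : of ℤ F y - 1 - z ∈ relAugIdeal f.ker := ker_mapDomainRingHom_le hf (by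
    rw [RingHom.mem_ker, map_sub, map_sub, map_one, mapDomainRingHom_of, hzg, sub_self])
  obtain ⟨r, hr, hrz⟩ := exists_sub_mem_augIdeal_mul_relAugIdeal hker
  refine ⟨r⁻¹ * y, inv_mul_mem_congruenceSubgroup.2 ?_, ?_⟩
  · have h : of ℤ F y - of ℤ F r = (of ℤ F y - 1 - z - (of ℤ F r - 1)) + z := by abel
    rw [h]
    exact Submodule.add_mem_sup hrz hz
  · rw [map_mul, map_inv, MonoidHom.mem_ker.1 hr, inv_one, one_mul]

end Map

section Congruent

variable {F Γ : Type*} [Group F] [Group Γ]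

theorem map_sub_map_mem_relAugIdeal {N : Subgroup Γ} (a b : F →* Γ)
    (hab : ∀ u, (a u)⁻¹ * b u ∈ N) (z : ℤ[F]) :
    mapDomainRingHom ℤ b z - mapDomainRingHom ℤ a z ∈ relAugIdeal N := by
  induction z using MonoidAlgebra.induction_on with
  | of u =>
    rw [mapDomainRingHom_of, mapDomainRingHom_of]
    exact inv_mul_mem_congruenceSubgroup.1 (le_congruenceSubgroup_relAugIdeal N (hab u))
  | add x y hx hy => rw [map_add, map_add, add_sub_add_comm]; exact add_mem hx hy
  | smul k x hx => rw [map_zsmul, map_zsmul, ← smul_sub]; exact zsmul_mem hx k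

theorem map_sub_map_mem_of_mem_augIdeal_pow {N : Subgroup Γ} [N.Normal] (a b : F →* Γ)
    (hab : ∀ u, (a u)⁻¹ * b u ∈ N) {n : ℕ} {z : ℤ[F]} (hz : z ∈ augIdeal F ^ (n + 1)) :
    mapDomainRingHom ℤ b z - mapDomainRingHom ℤ a z ∈
      augIdeal Γ * relAugIdeal N ⊔ relAugIdeal (N ⊓ gamma (n + 1) Γ) := by
  obtain _ | n := n
  · have h : N ⊓ gamma (0 + 1) Γ = N := inf_top_eq N
    rw [h]
    exact Ideal.mem_sup_right (map_sub_map_mem_relAugIdeal a b hab z)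
  rw [Submodule.pow_succ' _ n.succ_ne_zero] at hz
  refine Submodule.mul_induction_on hz (fun x hx y hy => ?_) fun x y hx hy => ?_
  · have hsplit : mapDomainRingHom ℤ b (x * y) - mapDomainRingHom ℤ a (x * y) =
        (mapDomainRingHom ℤ b x - mapDomainRingHom ℤ a x) * mapDomainRingHom ℤ b y +
          mapDomainRingHom ℤ a x * (mapDomainRingHom ℤ b y - mapDomainRingHom ℤ a y) := by
      rw [map_mul, map_mul]; noncomm_ring
    rw [hsplit]
    refine add_mem (relAugIdeal_mul_augIdeal_pow_le N _ (Ideal.mul_mem_mul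
      (map_sub_map_mem_relAugIdeal a b hab x) (augIdeal_pow_le_comap b _ hy))) ?_
    exact Ideal.mem_sup_left (Ideal.mul_mem_mul ((comap_augIdeal a).ge hx)
      (map_sub_map_mem_relAugIdeal a b hab y))
  · rw [map_add, map_add, add_sub_add_comm]; exact add_mem hx hy

theorem augIdeal_mul_relAugIdeal_le_comap {f : F →* Γ} {M : Subgroup F} {N : Subgroup Γ}
    (h : M ≤ N.comap f) : augIdeal F * relAugIdeal M ≤
      (augIdeal Γ * relAugIdeal N).comap (mapDomainRingHom ℤ f) :=
  Ideal.mul_le.2 fun z hz w hw => by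
    rw [Ideal.mem_comap, map_mul]
    exact Ideal.mul_mem_mul ((comap_augIdeal f).ge hz) (relAugIdeal_le_comap f h hw)

theorem inv_mul_mem_of_mem_congruenceSubgroup {N : Subgroup Γ} [N.Normal] {M : Subgroup F}
    {a b : F →* Γ} (ha : M ≤ N.comap a) (hab : ∀ u, (a u)⁻¹ * b u ∈ N) {n : ℕ} {x : F}
    (hx : x ∈ congruenceSubgroup (augIdeal F * relAugIdeal M ⊔ augIdeal F ^ (n + 1))) :
    (a x)⁻¹ * b x ∈ ⁅N, N⁆ ⊔ (N ⊓ gamma (n + 1) Γ) := by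
  have hb : M ≤ N.comap b := fun m hm => by
    have h := N.mul_mem (ha hm) (hab m)
    rwa [mul_inv_cancel_left] at h
  refine inf_congruenceSubgroup_le inf_le_left ⟨hab x, inv_mul_mem_congruenceSubgroup.2 ?_⟩
  obtain ⟨p, hp, q, hq, hpq⟩ := Submodule.mem_sup.1 hx
  have hsplit : of ℤ Γ (b x) - of ℤ Γ (a x) =
      mapDomainRingHom ℤ b p - mapDomainRingHom ℤ a p +
        (mapDomainRingHom ℤ b q - mapDomainRingHom ℤ a q) := by
    have h (f : F →* Γ) : mapDomainRingHom ℤ f p + mapDomainRingHom ℤ f q = of ℤ Γ (f x) - 1 := by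
      rw [← map_add, hpq, map_sub, map_one, mapDomainRingHom_of]
    rw [← add_sub_add_comm, h, h, sub_sub_sub_cancel_right]
  rw [hsplit]
  exact add_mem (Ideal.mem_sup_left (sub_mem (augIdeal_mul_relAugIdeal_le_comap hb hp)
    (augIdeal_mul_relAugIdeal_le_comap ha hp))) (map_sub_map_mem_of_mem_augIdeal_pow a b hab hq)

end Congruent

section CrossedHom

variable {Γ Γ' A M M' : Type*} [Group Γ] [Group Γ'] [Ring A] [AddCommGroup M] [Module A M]
  [AddCommGroup M'] [Module A M']

/-- Crossed homomorphisms (`1`-cocycles) `d : Γ → M`, where `Γ` acts on the `A`-module `M` through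
`ρ : Γ → A`. The Fox derivatives of a free group are of this kind. -/
def IsCrossedHom (ρ : Γ →* A) (d : Γ → M) : Prop :=
  ∀ u v, d (u * v) = d u + ρ u • d v

namespace IsCrossedHom

variable {ρ : Γ →* A} {d d' : Γ → M}

theorem comp (hd : IsCrossedHom ρ d) (f : Γ' →* Γ) : IsCrossedHom (ρ.comp f) (d ∘ f) :=
  fun u v => by rw [Function.comp_apply, map_mul, hd]; rfl

theorem linearMap_comp (hd : IsCrossedHom ρ d) (L : M →ₗ[A] M') : IsCrossedHom ρ (L ∘ d) :=
  fun u v => by simp only [Function.comp_apply, hd u v, map_add, map_smul]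

theorem map_one (hd : IsCrossedHom ρ d) : d 1 = 0 := by
  simpa using hd 1 1

theorem smul_map_inv_mul (hd : IsCrossedHom ρ d) (u v : Γ) : ρ u • d (u⁻¹ * v) = d v - d u := by
  rw [eq_sub_iff_add_eq', ← hd, mul_inv_cancel_left]

theorem map_inv (hd : IsCrossedHom ρ d) (u : Γ) : d u⁻¹ = -(ρ u⁻¹ • d u) := by
  have h := hd u⁻¹ u
  rw [inv_mul_cancel, hd.map_one] at h
  exact eq_neg_of_add_eq_zero_left h.symm

theorem sub_smul (ρ : Γ →* A) (m : M) : IsCrossedHom ρ fun u => ρ u • m - m := fun u v => by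
  simp only [map_mul, mul_smul, smul_sub]; abel

theorem eq_of_eqOn_closure (hd : IsCrossedHom ρ d) (hd' : IsCrossedHom ρ d') {s : Set Γ}
    (h : s.EqOn d d') {u : Γ} (hu : u ∈ Subgroup.closure s) : d u = d' u := by
  induction hu using Subgroup.closure_induction with
  | mem u hu => exact h hu
  | one => rw [hd.map_one, hd'.map_one]
  | mul u v _ _ hu hv => rw [hd, hd', hu, hv]
  | inv u _ hu => rw [hd.map_inv, hd'.map_inv, hu]

theorem eq_zero_of_mem_commutator (hd : IsCrossedHom ρ d) {u : Γ}
    (hu : u ∈ ⁅ρ.ker, ρ.ker⁆) : d u = 0 := by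
  let φ : ρ.ker →* Multiplicative M :=
    MonoidHom.mk' (fun r => Multiplicative.ofAdd (d r)) fun r s => by
      rw [Subgroup.coe_mul, hd, MonoidHom.mem_ker.1 r.2, one_smul, ofAdd_add]
  rw [← Subgroup.map_subtype_commutator] at hu
  obtain ⟨r, hr, rfl⟩ := hu
  exact Abelianization.commutator_subset_ker φ hr

end IsCrossedHom

theorem exists_isCrossedHom_freeGroup {X : Type*} (ρ : FreeGroup X →* A) (c : X → M) :
    ∃ d, IsCrossedHom ρ d ∧ ∀ x, d (FreeGroup.of x) = c x := by
  -- Crossed homomorphisms are the sections of the semidirect product `M ⋊ FreeGroup X`.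
  let ψ : FreeGroup X →* MulAut (Multiplicative M) :=
    (MulAutMultiplicative M).symm.toMonoidHom.comp
      ((DistribMulAction.toAddAut Aˣ M).comp ρ.toHomUnits)
  let φ : FreeGroup X →* Multiplicative M ⋊[ψ] FreeGroup X :=
    FreeGroup.lift fun x => ⟨Multiplicative.ofAdd (c x), FreeGroup.of x⟩
  have hφ : SemidirectProduct.rightHom.comp φ = MonoidHom.id _ := FreeGroup.ext_hom _ _ fun x => by
    simp only [φ, MonoidHom.comp_apply, FreeGroup.lift_apply_of, MonoidHom.id_apply]; rfl
  refine ⟨fun u => (φ u).left.toAdd, fun u v => ?_, fun x => ?_⟩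
  · have hu : (φ u).right = u := DFunLike.congr_fun hφ u
    change (φ (u * v)).left.toAdd = _
    rw [map_mul, SemidirectProduct.mul_left, hu]
    rfl
  · simp only [φ, FreeGroup.lift_apply_of]; rfl

theorem IsCrossedHom.freeGroup_ext {X A M : Type*} [Ring A] [AddCommGroup M] [Module A M]
    {ρ : FreeGroup X →* A} {d d' : FreeGroup X → M} (hd : IsCrossedHom ρ d)
    (hd' : IsCrossedHom ρ d') (h : ∀ x, d (FreeGroup.of x) = d' (FreeGroup.of x))
    (u : FreeGroup X) : d u = d' u :=
  hd.eq_of_eqOn_closure hd' (s := Set.range FreeGroup.of) (Set.forall_mem_range.2 h)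
    (by rw [FreeGroup.closure_range_of]; exact Subgroup.mem_top u)

theorem IsCrossedHom.mem_smul_top_of_mem_gamma {Γ G M : Type*} [Group Γ] [Group G] [AddCommGroup M]
    [Module ℤ[G] M] {π : Γ →* G} {d : Γ → M} (hd : IsCrossedHom ((of ℤ G).comp π) d) {n : ℕ} {y : Γ}
    (hy : y ∈ gamma (n + 1) Γ) : d y ∈ augIdeal G ^ n • (⊤ : Submodule ℤ[G] M) := by
  let D := (MonoidAlgebra.basis Γ ℤ).constr ℤ d
  have hD (u : Γ) : D (of ℤ Γ u) = d u := (MonoidAlgebra.basis Γ ℤ).constr_basis ℤ d u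
  have hD' (u : Γ) : D (of ℤ Γ u - 1) = d u := by
    rw [map_sub, hD, ← _root_.map_one (of ℤ Γ), hD, hd.map_one, sub_zero]
  have hmul : ∀ z, ∀ w ∈ augIdeal Γ, D (z * w) = mapDomainRingHom ℤ π z • D w := fun z w hw => by
    rw [augIdeal_eq_relAugIdeal_top] at hw
    refine map_mul_of_mem_relAugIdeal (mapDomainRingHom ℤ π) D.toAddMonoidHom (fun u v _ => ?_) z hw
    change D (of ℤ Γ u * (of ℤ Γ v - 1)) = mapDomainRingHom ℤ π (of ℤ Γ u) • D (of ℤ Γ v - 1)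
    rw [hD', mul_sub, mul_one, ← map_mul, map_sub, hD, hD, hd, add_sub_cancel_left,
      mapDomainRingHom_of]
    rfl
  have hpow : ∀ z ∈ augIdeal Γ ^ (n + 1), D z ∈ augIdeal G ^ n • (⊤ : Submodule ℤ[G] M) := by
    intro z hz
    rw [Submodule.pow_succ] at hz
    refine Submodule.mul_induction_on hz (fun x hx w hw => ?_) fun x w hx hw => ?_
    · rw [hmul x w hw]
      exact Submodule.smul_mem_smul (augIdeal_pow_le_comap π n hx) Submodule.mem_top
    · rw [map_add]
      exact add_mem hx hw
  exact hD' y ▸ hpow _ (gamma_succ_le_congruenceSubgroup n hy)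

theorem IsCrossedHom.mem_smul_top_of_mem_sup {Γ G M : Type*} [Group Γ] [Group G] [AddCommGroup M]
    [Module ℤ[G] M] {π : Γ →* G} {d : Γ → M} (hd : IsCrossedHom ((of ℤ G).comp π) d) {n : ℕ} {y : Γ}
    (hy : y ∈ ⁅π.ker, π.ker⁆ ⊔ gamma (n + 1) Γ) :
    d y ∈ augIdeal G ^ n • (⊤ : Submodule ℤ[G] M) := by
  obtain ⟨r, hr, v, hv, rfl⟩ := Subgroup.mem_sup_of_normal_left.1 hy
  have hker : π.ker ≤ ((of ℤ G).comp π).ker := fun u hu => by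
    rw [MonoidHom.mem_ker, MonoidHom.comp_apply, MonoidHom.mem_ker.1 hu, _root_.map_one]
  have hr₀ : d r = 0 := hd.eq_zero_of_mem_commutator (Subgroup.commutator_mono hker hker hr)
  rw [hd, hr₀, zero_add]
  exact Submodule.smul_mem _ _ (hd.mem_smul_top_of_mem_gamma hv)

theorem map_subtype_pow_smul_top {A : Type*} [Ring A] (J : Ideal A) (n : ℕ) :
    (J ^ n • (⊤ : Submodule A J)).map (Submodule.subtype J) = J ^ (n + 1) := by
  rw [Submodule.map_smul'', Submodule.map_top, Submodule.range_subtype, Submodule.pow_succ]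
  rfl

theorem lift_mem_congruenceSubgroup_of_inl_inv_mul_inr {X G : Type*} [Group G] (p : X → G)
    {n : ℕ} {x : FreeGroup X}
    (hx : (FreeGroup.lift (fun x => FreeGroup.of (Sum.inl x)) x)⁻¹ *
        FreeGroup.lift (fun x => FreeGroup.of (Sum.inr x)) x ∈
      ⁅(FreeGroup.lift (Sum.elim p p)).ker, (FreeGroup.lift (Sum.elim p p)).ker⁆ ⊔
        gamma (n + 1) (FreeGroup (X ⊕ X))) :
    FreeGroup.lift p x ∈ congruenceSubgroup (augIdeal G ^ (n + 1)) := by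
  let π : FreeGroup (X ⊕ X) →* G := FreeGroup.lift (Sum.elim p p)
  let a : FreeGroup X →* FreeGroup (X ⊕ X) := FreeGroup.lift fun x => FreeGroup.of (Sum.inl x)
  let b : FreeGroup X →* FreeGroup (X ⊕ X) := FreeGroup.lift fun x => FreeGroup.of (Sum.inr x)
  -- `d` kills the second copy of `X` and restricts to `u ↦ u - 1` on the first one.
  obtain ⟨d, hd, hdX⟩ := exists_isCrossedHom_freeGroup ((of ℤ G).comp π)
    (Sum.elim (fun x => (⟨of ℤ G (p x) - 1, of_sub_one_mem_augIdeal _⟩ : augIdeal G)) 0)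
  have hπa : π.comp a = FreeGroup.lift p := FreeGroup.ext_hom _ _ fun x => by
    simp only [π, a, MonoidHom.comp_apply, FreeGroup.lift_apply_of, Sum.elim_inl]
  have ha : (d (a x) : ℤ[G]) = of ℤ G (FreeGroup.lift p x) - 1 := by
    have hda : IsCrossedHom ((of ℤ G).comp (FreeGroup.lift p)) fun u => (d (a u) : ℤ[G]) :=
      hπa ▸ (hd.comp a).linearMap_comp (augIdeal G).subtype
    have hprin := IsCrossedHom.sub_smul ((of ℤ G).comp (FreeGroup.lift p)) (1 : ℤ[G])
    rw [hda.freeGroup_ext hprin (fun x => ?_) x, smul_eq_mul, mul_one]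
    · rfl
    · simp only [a, FreeGroup.lift_apply_of, hdX, Sum.elim_inl, MonoidHom.comp_apply,
        smul_eq_mul, mul_one]
  have hb : d (b x) = 0 :=
    (hd.comp b).freeGroup_ext (d' := 0)
      (fun _ _ => by simp only [Pi.zero_apply, smul_zero, add_zero])
      (fun x => by
        simp only [b, Function.comp_apply, FreeGroup.lift_apply_of, hdX, Sum.elim_inr,
          Pi.zero_apply]) x
  rw [mem_congruenceSubgroup, ← ha, ← map_subtype_pow_smul_top]
  refine Submodule.mem_map_of_mem ?_
  have h := hd.smul_map_inv_mul (a x) (b x)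
  rw [hb, zero_sub] at h
  exact neg_mem_iff.1 (h ▸ Submodule.smul_mem _ _ (hd.mem_smul_top_of_mem_sup hx))

end CrossedHom

section FreeLim

variable {T T' : Presentation.{u} ⥤ AddCommGrpCat.{u}} {G : GrpCat.{u}}

theorem map_comp_freeLimProj {H : GrpCat.{u}} (φ : G ⟶ H) {P : FreePresentation G}
    {Q : FreePresentation H} (a : (⟨G, P⟩ : Presentation) ⟶ ⟨H, Q⟩) (ha : a.φ = φ) :
    (freeLim T).map φ ≫ freeLimProj T H Q = freeLimProj T G P ≫ T.map a :=
  freeLimMap_π T φ a ha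

theorem freeLimProj_comp_map {P Q : FreePresentation G}
    (a : (⟨G, P⟩ : Presentation) ⟶ ⟨G, Q⟩) (ha : a.φ = 𝟙 G) :
    freeLimProj T G P ≫ T.map a = freeLimProj T G Q := by
  rw [← map_comp_freeLimProj (𝟙 G) a ha, (freeLim T).map_id, Category.id_comp]

theorem freeLimHom_app_freeLimProj (α : T ⟶ T') (P : FreePresentation G)
    (s : (freeLim T).obj G) :
    freeLimProj T' G P ((freeLimHom α).app G s) = α.app ⟨G, P⟩ (freeLimProj T G P s) :=
  ConcreteCategory.congr_hom (limMap_comp_π α G P) s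

theorem freeLimProj_std_injective : Function.Injective (freeLimProj T G (std G)) := by
  rw [← AddCommGrpCat.mono_iff_injective]
  refine ⟨fun a b hab => limit.hom_ext fun Q => ?_⟩
  change a ≫ freeLimProj T G Q = b ≫ freeLimProj T G Q
  rw [← freeLimProj_comp_map (stdLift (𝟙 G) Q) rfl, reassoc_of% hab]

theorem map_stdInl_freeLimProj_eq_map_stdInr (s : (freeLim T).obj G) :
    T.map ((fibre G).map (stdInl G)) (freeLimProj T G (std G) s) =
      T.map ((fibre G).map (stdInr G)) (freeLimProj T G (std G) s) :=
  ConcreteCategory.congr_hom (cone_inl_eq_inr T (limit.cone (fibre G ⋙ T))) s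

theorem exists_freeLimProj_std_eq {t : T.obj ((fibre G).obj (std G))}
    (ht : T.map ((fibre G).map (stdInl G)) t = T.map ((fibre G).map (stdInr G)) t) :
    ∃ s, freeLimProj T G (std G) s = t := by
  let E := AddMonoidHom.eqLocus (T.map ((fibre G).map (stdInl G))).hom
    (T.map ((fibre G).map (stdInr G))).hom
  let k : AddCommGrpCat.of E ⟶ T.obj ((fibre G).obj (std G)) := AddCommGrpCat.ofHom E.subtype
  have hk : k ≫ T.map ((fibre G).map (stdInl G)) = k ≫ T.map ((fibre G).map (stdInr G)) :=
    AddCommGrpCat.ext fun x => x.2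
  let c : Cone (fibre G ⋙ T) :=
    { pt := AddCommGrpCat.of E
      π :=
        { app Q := k ≫ T.map (stdLift (𝟙 G) Q)
          naturality Q Q' a := by
            have h := comp_eq_of_lift T k hk (stdLift (𝟙 G) Q')
              (stdLift (𝟙 G) Q ≫ (fibre G).map a) (Category.id_comp (𝟙 G)).symm
            simpa using h } }
  have hc : limit.lift _ c ≫ freeLimProj T G (std G) = k :=
    (limit.lift_π c (std G)).trans <|
      (comp_eq_of_lift T k hk (stdLift (𝟙 G) (std G)) (𝟙 _) rfl).trans <| by
        rw [T.map_id, Category.comp_id]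
  exact ⟨limit.lift _ c ⟨t, ht⟩, ConcreteCategory.congr_hom hc ⟨t, ht⟩⟩

theorem freeLimHom_app_injective (ι : T ⟶ T') (hι : ∀ P, Function.Injective (ι.app P)) :
    Function.Injective ((freeLimHom ι).app G) := fun s s' h => by
  refine freeLimProj_std_injective (hι _ ?_)
  rw [← freeLimHom_app_freeLimProj, h, freeLimHom_app_freeLimProj]

theorem exists_freeLimHom_app_eq (ι : T ⟶ T') (hι : ∀ P, Function.Injective (ι.app P))
    {s : (freeLim T').obj G} {t : T.obj ⟨G, std G⟩}
    (ht : ι.app ⟨G, std G⟩ t = freeLimProj T' G (std G) s) :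
    ∃ r, (freeLimHom ι).app G r = s := by
  have hcomm (a : (⟨G, std G⟩ : Presentation) ⟶ ⟨G, stdTwo G⟩) :
      ι.app ⟨G, stdTwo G⟩ (T.map a t) = T'.map a (freeLimProj T' G (std G) s) :=
    (NatTrans.naturality_apply ι a t).trans (congrArg _ ht)
  obtain ⟨r, rfl⟩ := exists_freeLimProj_std_eq (T := T) (t := t) <| hι _ <|
    (hcomm _).trans <| (map_stdInl_freeLimProj_eq_map_stdInr s).trans (hcomm _).symm
  exact ⟨r, freeLimProj_std_injective ((freeLimHom_app_freeLimProj ι _ r).trans ht)⟩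

variable {S : GrpCat.{u} ⥤ AddCommGrpCat.{u}}

/-- The natural transformation out of the limit over free presentations of `G` induced by maps
from `T (R ↪ F ↠ G)` to a functor of `G` alone; by `freeLimDesc_app` it may be computed at any
presentation. -/
noncomputable def freeLimDesc (α : T ⟶ presented ⋙ S) : freeLim T ⟶ S where
  app G := freeLimProj T G (std G) ≫ α.app ⟨G, std G⟩
  naturality G H φ := AddCommGrpCat.ext fun s => by
    let m : (⟨G, std G⟩ : Presentation) ⟶ ⟨H, std H⟩ := stdLift φ (std H)
    exact (congrArg (α.app ⟨H, std H⟩)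
      (ConcreteCategory.congr_hom (map_comp_freeLimProj φ m rfl) s)).trans
      (ConcreteCategory.congr_hom (α.naturality m) (freeLimProj T G (std G) s))

theorem freeLimDesc_app (α : T ⟶ presented ⋙ S) (P : FreePresentation G) :
    (freeLimDesc α).app G = freeLimProj T G P ≫ α.app ⟨G, P⟩ := by
  let m : (⟨G, std G⟩ : Presentation) ⟶ ⟨G, P⟩ := stdLift (𝟙 G) P
  have hm : T.map m ≫ α.app ⟨G, P⟩ = α.app ⟨G, std G⟩ := by
    rw [α.naturality m]
    exact (congrArg _ (S.map_id G)).trans (Category.comp_id _)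
  rw [← freeLimProj_comp_map m rfl, Category.assoc, hm]
  rfl

theorem freeLimHom_comp_freeLimDesc {ι : T' ⟶ T} {α : T ⟶ presented ⋙ S}
    (h : ∀ P, ι.app P ≫ α.app P = 0) : (freeLimHom ι).app G ≫ (freeLimDesc α).app G = 0 :=
  AddCommGrpCat.ext fun s =>
    (congrArg (α.app ⟨G, std G⟩) (freeLimHom_app_freeLimProj ι (std G) s)).trans
      (ConcreteCategory.congr_hom (h ⟨G, std G⟩) _)

end FreeLim

theorem exists_natTrans_fac {C : Type*} [Category* C] {A B D : C ⥤ AddCommGrpCat.{u}} (f : A ⟶ D)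
    (i : B ⟶ D) (hi : ∀ X, Function.Injective (i.app X))
    (h : ∀ X a, ∃ b, i.app X b = f.app X a) : ∃ q : A ⟶ B, q ≫ i = f := by
  choose q hq using h
  let q' (X : C) : A.obj X ⟶ B.obj X :=
    AddCommGrpCat.ofHom (AddMonoidHom.mk' (q X) fun a b => hi X (by simp only [map_add, hq]))
  have hq' (X : C) : q' X ≫ i.app X = f.app X := AddCommGrpCat.ext (hq X)
  refine ⟨⟨q', fun X Y φ => ?_⟩, NatTrans.ext (funext hq')⟩
  have := (AddCommGrpCat.mono_iff_injective _).2 (hi Y)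
  rw [← cancel_mono (i.app Y), Category.assoc, Category.assoc, hq', f.naturality, i.naturality,
    reassoc_of% hq']

theorem freeLimHom_shortExact {T' T : Presentation.{u} ⥤ AddCommGrpCat.{u}}
    {S D : GrpCat.{u} ⥤ AddCommGrpCat.{u}} {ι : T' ⟶ T} {α : T ⟶ presented ⋙ S}
    (hι : ∀ P, Function.Injective (ι.app P)) (hια : ∀ P, ι.app P ≫ α.app P = 0)
    (hα : ∀ P t, α.app P t = 0 → ∃ r, ι.app P r = t) {q : freeLim T ⟶ D} {i : D ⟶ S}
    (hq : q ≫ i = freeLimDesc α) (hi : ∀ G, Function.Injective (i.app G))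
    (hD : ∀ G d, ∃ s, (freeLimDesc α).app G s = i.app G d) (G : GrpCat.{u}) :
    ∃ w : (freeLimHom ι).app G ≫ q.app G = 0, (ShortComplex.mk _ _ w).ShortExact := by
  have hmono := (AddCommGrpCat.mono_iff_injective _).2 (hi G)
  have hqG : q.app G ≫ i.app G = (freeLimDesc α).app G := NatTrans.congr_app hq G
  have hqG' (s) : i.app G (q.app G s) = (freeLimDesc α).app G s :=
    ConcreteCategory.congr_hom hqG s
  have w : (freeLimHom ι).app G ≫ q.app G = 0 := by
    rw [← cancel_mono (i.app G), Category.assoc, hqG, freeLimHom_comp_freeLimDesc hια, zero_comp]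
  refine ⟨w, {
    exact := ?_
    mono_f := (AddCommGrpCat.mono_iff_injective _).2 (freeLimHom_app_injective ι hι)
    epi_g := (AddCommGrpCat.epi_iff_surjective _).2 fun d => ?_ }⟩
  · refine (ShortComplex.ab_exact_iff _).2 fun s hs => ?_
    obtain ⟨r, hr⟩ := hα ⟨G, std G⟩ (freeLimProj T G (std G) s)
      ((hqG' s).symm.trans ((congrArg _ hs).trans (map_zero _)))
    exact exists_freeLimHom_app_eq ι hι hr
  · obtain ⟨s, hs⟩ := hD G d
    exact ⟨s, hi G ((hqG' s).trans hs)⟩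

section Subquotients

variable {F : Type u} [Group F] {H N : Subgroup F}

theorem subquotMk_eq_iff {h : ⁅H, H⁆ ≤ N} {x y : H} :
    subquotMk H N h x = subquotMk H N h y ↔ (x : F)⁻¹ * y ∈ N :=
  (QuotientGroup.eq (s := N.subgroupOf H) (a := x) (b := y)).trans Subgroup.mem_subgroupOf

theorem subquotMk_eq_zero_iff {h : ⁅H, H⁆ ≤ N} {x : H} :
    subquotMk H N h x = 0 ↔ (x : F) ∈ N :=
  (subquotMk_eq_iff (y := 1)).trans (by rw [OneMemClass.coe_one, mul_one, inv_mem_iff])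

end Subquotients

section DimensionQuotient

theorem dimQuotIncl_injective (G : GrpCat.{u}) : Function.Injective (dimQuotIncl.app G) := by
  refine (injective_iff_map_eq_zero _).2 fun a ha => ?_
  obtain ⟨x, rfl⟩ := subquotMk_surjective _ _ _ a
  have hx : (x : G) ∈ gamma 4 G :=
    (subquotMk_eq_zero_iff (h := commutator_gamma_two_le G)
      (x := ⟨x, dimSubgroup_four_le G x.2⟩)).1 ha
  exact subquotMk_eq_zero_iff.2 hx

theorem inf_commutator_sup_le {F : Type*} [Group F] {R H : Subgroup F} [R.Normal] :
    R ⊓ (⁅R, R⁆ ⊔ H) ≤ ⁅R, R⁆ ⊔ (R ⊓ H) := by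
  rintro x ⟨hx, hx'⟩
  obtain ⟨c, hc, d, hd, rfl⟩ := Subgroup.mem_sup_of_normal_left.1 hx'
  have hcR : c ∈ R := Subgroup.commutator_le_left _ _ hc
  exact Subgroup.mul_mem_sup hc ⟨(R.mul_mem_cancel_left hcR).1 hx, hd⟩

theorem relIncl_injective (P : Presentation.{u}) : Function.Injective (relIncl.app P) := by
  refine (injective_iff_map_eq_zero _).2 fun a ha => ?_
  obtain ⟨x, rfl⟩ := subquotMk_surjective _ _ _ a
  have hx : (x : P.P.F) ∈ ⁅rel P, rel P⁆ ⊔ gamma 4 P.P.F :=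
    (subquotMk_eq_zero_iff (h := (commutator_gamma_two_le _).trans le_sup_right)
      (x := ⟨(x : P.P.F), x.2.2⟩)).1 ha
  exact subquotMk_eq_zero_iff.2 (inf_commutator_sup_le ⟨x.2.1, hx⟩)

theorem relIncl_comp_freeProj (P : Presentation.{u}) : relIncl.app P ≫ freeProj.app P = 0 :=
  subquot_hom_ext fun x => by
    have hx : P.P.π x = 1 := x.2.1
    have hx₄ : P.P.π x ∈ gamma 4 P.G := hx ▸ one_mem _
    exact subquotMk_eq_zero_iff.2 hx₄

theorem exists_relIncl_app_eq (P : Presentation.{u}) (t : freeQuot.obj P)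
    (ht : freeProj.app P t = 0) : ∃ s, relIncl.app P s = t := by
  obtain ⟨x, rfl⟩ := subquotMk_surjective _ _ _ t
  have hx : P.P.π x ∈ gamma 4 P.G := subquotMk_eq_zero_iff.1 ht
  have hmap : (gamma 4 P.P.F).map P.P.π = gamma 4 P.G := by
    rw [gamma, gamma, Subgroup.map_lowerCentralSeries, Subgroup.map_top_of_surjective _ P.P.surj]
  obtain ⟨y, hy, hyx⟩ := hmap.ge hx
  have hy₂ : y ∈ gamma 2 P.P.F := Subgroup.lowerCentralSeries_antitone _ (by decide) hy
  have hxy : (x : P.P.F) * y⁻¹ ∈ rel P := by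
    rw [MonoidHom.mem_ker, map_mul, map_inv, hyx, mul_inv_cancel]
  refine ⟨subquotMk _ _ _ ⟨_, hxy, (gamma 2 _).mul_mem x.2 ((gamma 2 _).inv_mem hy₂)⟩,
    subquotMk_eq_iff.2 ?_⟩
  change (x * y⁻¹)⁻¹ * (x : P.P.F) ∈ _
  rw [mul_inv_rev, inv_inv, inv_mul_cancel_right]
  exact Subgroup.mem_sup_right hy

theorem congruenceSubgroup_le_gamma_two {Γ : Type*} [Group Γ] (M : Subgroup Γ) (n : ℕ) :
    congruenceSubgroup (augIdeal Γ * relAugIdeal M ⊔ augIdeal Γ ^ (n + 2)) ≤ gamma 2 Γ := by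
  have hle : augIdeal Γ * relAugIdeal M ⊔ augIdeal Γ ^ (n + 2) ≤
      augIdeal Γ * relAugIdeal ⊤ ⊔ relAugIdeal ⊥ := by
    refine le_sup_of_le_left (sup_le (Ideal.mul_mono_right (relAugIdeal_mono le_top)) ?_)
    rw [← augIdeal_eq_relAugIdeal_top, Submodule.pow_succ, Submodule.pow_succ]
    exact Ideal.mul_mono_left Ideal.mul_le_right
  intro x hx
  have h := inf_congruenceSubgroup_le bot_le ⟨Subgroup.mem_top x, hle hx⟩
  rwa [sup_bot_eq] at h

theorem exists_dimQuotIncl_app_eq (G : GrpCat.{u}) (s : (freeLim freeQuot).obj G) :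
    ∃ d, dimQuotIncl.app G d = (freeLimDesc freeProj).app G s := by
  obtain ⟨x, hx⟩ := subquotMk_surjective _ _ _ (freeLimProj freeQuot G (std G) s)
  have h := map_stdInl_freeLimProj_eq_map_stdInr s
  rw [← hx] at h
  have hG : (std G).π x ∈ dimSubgroup 4 G :=
    lift_mem_congruenceSubgroup_of_inl_inv_mul_inr _ (subquotMk_eq_iff.1 h)
  exact ⟨subquotMk _ _ _ ⟨_, hG⟩, congrArg (freeProj.app ⟨G, std G⟩) hx⟩

theorem exists_freeLimDesc_app_eq (G : GrpCat.{u}) (d : dimQuotFour.obj G) :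
    ∃ s, (freeLimDesc freeProj).app G s = dimQuotIncl.app G d := by
  obtain ⟨⟨g, hg⟩, rfl⟩ := subquotMk_surjective _ _ _ d
  obtain ⟨x, hx, rfl⟩ := exists_lift_mem_congruenceSubgroup (std G).surj hg
  have hx₂ : x ∈ gamma 2 (std G).F := congruenceSubgroup_le_gamma_two _ 2 hx
  let R := (stdTwo G).π.ker
  have hab (u) : ((stdInl G).f u)⁻¹ * (stdInr G).f u ∈ R := by
    rw [MonoidHom.mem_ker, map_mul, map_inv, (stdInl G).comm, (stdInr G).comm, inv_mul_cancel]
  have ha : (std G).π.ker ≤ R.comap (stdInl G).f := fun r hr => ((stdInl G).comm r).trans hr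
  have hle : ⁅R, R⁆ ⊔ (R ⊓ gamma 4 _) ≤ ⁅R, R⁆ ⊔ gamma 4 _ := sup_le_sup_left inf_le_right _
  have h := hle (inv_mul_mem_of_mem_congruenceSubgroup ha hab hx)
  obtain ⟨s, hs⟩ := exists_freeLimProj_std_eq (T := freeQuot) (t := subquotMk _ _ _ ⟨x, hx₂⟩)
    (subquotMk_eq_iff.2 h)
  exact ⟨s, congrArg (freeProj.app ⟨G, std G⟩) hs⟩

end DimensionQuotient

end DimQuot

/-- There is a natural transformation `q : lim γ₂(F)/(γ₂(R)γ₄(F)) ⟶ D₄(G)/γ₄(G)` of functors of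
the group `G`, induced by the projections `F ↠ G`, that forms a short exact sequence together
with the map `lim (R ∩ γ₂(F))/(γ₂(R)(R ∩ γ₄(F))) ⟶ lim γ₂(F)/(γ₂(R)γ₄(F))` induced by the
inclusions `R ∩ γ₂(F) ≤ γ₂(F)`. -/
theorem theorem1 :
    ∃ q : DimQuot.freeLim DimQuot.freeQuot.{u} ⟶ DimQuot.dimQuotFour.{u},
      (∀ (G : GrpCat.{u}) (P : DimQuot.FreePresentation G),
        q.app G ≫ DimQuot.dimQuotIncl.app G =
          DimQuot.freeLimProj DimQuot.freeQuot G P ≫ DimQuot.freeProj.app ⟨G, P⟩) ∧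
      ∀ G : GrpCat.{u},
        ∃ w : (DimQuot.freeLimHom DimQuot.relIncl).app G ≫ q.app G = 0,
          (ShortComplex.mk _ _ w).ShortExact := by
  obtain ⟨q, hq⟩ := DimQuot.exists_natTrans_fac (DimQuot.freeLimDesc DimQuot.freeProj)
    DimQuot.dimQuotIncl DimQuot.dimQuotIncl_injective DimQuot.exists_dimQuotIncl_app_eq
  have hqP (G : GrpCat.{u}) (P : DimQuot.FreePresentation G) :=
    (NatTrans.congr_app hq G).trans (DimQuot.freeLimDesc_app DimQuot.freeProj P)
  exact ⟨q, hqP, DimQuot.freeLimHom_shortExact DimQuot.relIncl_injective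
    DimQuot.relIncl_comp_freeProj DimQuot.exists_relIncl_app_eq hq DimQuot.dimQuotIncl_injective
    DimQuot.exists_freeLimDesc_app_eq⟩
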